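/- All processes live on a probability space $(\Omega,\mathcal F,P)$ and are indexed by $[0,1]$ or $[0,1)$; path properties and identities between processes hold almost surely. For $T\in[0,1]$, a continuous process $X$ on $[0,T]$, extended by $X_t=X_T$ for $t>T$, and a process $Y$ with paths in $L^1([0,T])$, we say that $Y$ is *$X$-forward integrable on $[0,T]$* with forward integral $\int_0^\cdot Y\,d^-X$ if, for every $t\in[0,T]$, $\frac1\varepsilon\int_0^tY_s(X_{s+\varepsilon}-X_s)\,ds$ converges in probability as $\varepsilon\downarrow0$ and the limiting process has a continuous version $\int_0^\cdot Y\,d^-X$. A process $Y$ on $[0,1)$ is *locally $X$-forward integrable* if $Y I_{[0,t]}$ is $X$-forward integrable on $[0,1]$ for every $t<1$; then $\int_0^\cdot Y\,d^-X$ is the continuous process on $[0,1)$ that coincides on each $[0,t]$, $t<1$, with the forward integral of $YI_{[0,t]}$. It is *$X$-improperly forward integrable* if moreover $\lim_{t\to1}\int_0^tY\,d^-X$ exists almost surely. The quadratic variation $[X]$ is the limit, uniformly on $[0,1]$ in probability, of $\frac1\varepsilon\int_0^\cdot(X_{s+\varepsilon}-X_s)^2\,ds$ as $\varepsilon\downarrow0$,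 when this limit exists. *Market.* Let $\mathbb G=(\mathcal G_t)_{t\in[0,1]}$ be a filtration satisfying the usual conditions, let $r>0$, $\sigma>0$, and let the less risky asset have price $S^0_t=e^{rt}$. Let $S=(S_t)_{t\in[0,1]}$ be a $\mathbb G$-adapted, continuous, strictly positive process with $[S]_t=\int_0^t\sigma^2S_s^2\,ds$; $S$ is not assumed to be a semimartingale. A *self-financing portfolio* is a pair $(X_0,h)$, where $X_0$ is a $\mathcal G_0$-measurable random variable and $h=(h_t)_{0\le t<1}$ is a $\mathbb G$-adapted, locally $S$-forward integrable process whose paths are left continuous and bounded on each compact subset of $[0,1)$. Its wealth process $X$ on $[0,1)$ is given by $$e^{-rt}X_t=X_0-\int_0^te^{-rs}h_sS_s\,r\,ds+\int_0^te^{-rs}\,d^-\Big(\int_0^sh_u\,d^-S_u\Big),\qquad 0\le t<1.$$ The portfolio *replicates* a random variable $C$ if $h$ is $S$-improperly forward integrable and $\lim_{t\to1}X_t=C$ almost surely. **Proposition.** Let $\psi\in C^0(\mathbb R)$, and let $v\in C^{1,2}([0,1)\times\mathbb R)\cap C^0([0,1]\times\mathbb R)$ satisfy $$\tfrac12\sigma^2y^2\,\partial_{yy}v(t,y)+(1-ry)\,\partial_yv(t,y)+\partial_tv(t,y)=0\quad\text{on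 }[0,1)\times\mathbb R,\qquad v(1,y)=\psi(y)\quad\text{for all }y\in\mathbb R.$$ Let $K>0$ and set $Z_t=\int_0^tS_s\,ds-K$, $$X_0=v\Big(0,-\frac{K}{S_0}\Big)S_0,\qquad h_t=v\Big(t,\frac{Z_t}{S_t}\Big)-\partial_yv\Big(t,\frac{Z_t}{S_t}\Big)\frac{Z_t}{S_t},\quad 0\le t<1.$$ Then $(X_0,h)$ is a self-financing portfolio, and it replicates the contingent claim $$\psi\Big(\frac1{S_1}\Big(\int_0^1S_t\,dt-K\Big)\Big)S_1.$$ -/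

import Mathlib

open Set Filter Topology MeasureTheory

/-! Stochastic calculus via regularization. A process is a map `ℝ → Ω → ℝ`; a process on `[0,T]`
(or `[0,1)`) is only ever evaluated at times in that interval. All path properties and identities
between processes are understood almost surely. -/

noncomputable section

variable {Ω : Type*}

/-- `I(ε,Y,X,t) = ε⁻¹ ∫₀ᵗ Y_s (X_{s+ε} - X_s) ds` for processes on `[0,T]`, with the convention
that `X` is extended by its value at `T` to times larger than `T`. -/
def forwardReg (T : ℝ) (Y X : ℝ → Ω → ℝ) (ε t : ℝ) (ω : Ω) : ℝ :=
  ε⁻¹ * ∫ s in (0 : ℝ)..t, Y s ω * (X (min (s + ε) T) ω - X s ω)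

/-- `C(ε,X,Y,t) = ε⁻¹ ∫₀ᵗ (Y_{s+ε} - Y_s) (X_{s+ε} - X_s) ds` for processes on `[0,T]`, with the
same convention. -/
def covarReg (T : ℝ) (X Y : ℝ → Ω → ℝ) (ε t : ℝ) (ω : Ω) : ℝ :=
  ε⁻¹ * ∫ s in (0 : ℝ)..t,
    (Y (min (s + ε) T) ω - Y s ω) * (X (min (s + ε) T) ω - X s ω)

/-- Uniform convergence in probability on `[0,T]` of the family `F ε`, as `ε` tends to zero from
the right, to the process `G`. -/
def TendstoUCP [MeasurableSpace Ω] (μ : Measure Ω) (T : ℝ) (F : ℝ → ℝ → Ω → ℝ)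
    (G : ℝ → Ω → ℝ) : Prop :=
  ∀ δ : ENNReal, 0 < δ →
    Tendsto (fun ε : ℝ => μ {ω | δ ≤ ⨆ t ∈ Icc (0 : ℝ) T, edist (F ε t ω) (G t ω)})
      (𝓝[>] 0) (𝓝 0)

/-- `Q` is the covariation process `[X,Y]` on `[0,T]`. -/
def IsCovariation [MeasurableSpace Ω] (μ : Measure Ω) (T : ℝ) (X Y Q : ℝ → Ω → ℝ) : Prop :=
  TendstoUCP μ T (covarReg T X Y) Q

/-- `Y` is `X`-forward integrable on `[0,T]`, with forward integral process `J = ∫₀^· Y d⁻X`. -/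
structure IsForwardIntegral [MeasurableSpace Ω] (μ : Measure Ω) (T : ℝ)
    (Y X J : ℝ → Ω → ℝ) : Prop where
  continuous_integrator : ∀ᵐ ω ∂μ, ContinuousOn (fun t => X t ω) (Icc 0 T)
  integrable_integrand : ∀ᵐ ω ∂μ, IntegrableOn (fun t => Y t ω) (Icc 0 T)
  continuous_integral : ∀ᵐ ω ∂μ, ContinuousOn (fun t => J t ω) (Icc 0 T)
  tendsto : ∀ t ∈ Icc (0 : ℝ) T,
    TendstoInMeasure μ (fun ε ω => forwardReg T Y X ε t ω) (𝓝[>] 0) (J t)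

/-- The process `Y I_{[0,t]}`. -/
def truncAt (t : ℝ) (Y : ℝ → Ω → ℝ) (s : ℝ) (ω : Ω) : ℝ :=
  (Icc 0 t).indicator (fun u => Y u ω) s

/-- `Y` is locally `X`-forward integrable on `[0,1)`: each `Y I_{[0,t]}`, `t < 1`, is
`X`-forward integrable on `[0,1]`. -/
def LocallyForwardIntegrable [MeasurableSpace Ω] (μ : Measure Ω) (Y X : ℝ → Ω → ℝ) : Prop :=
  ∀ t ∈ Ico (0 : ℝ) 1, ∃ I, IsForwardIntegral μ 1 (truncAt t Y) X I

/-- `J` is the local forward integral `∫₀^· Y d⁻X` on `[0,1)`: it is continuous on `[0,1)` and, for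
each `t < 1`, it coincides on `[0,t]` with the forward integral of `Y I_{[0,t]}`. -/
def IsLocalForwardIntegral [MeasurableSpace Ω] (μ : Measure Ω) (Y X J : ℝ → Ω → ℝ) : Prop :=
  (∀ᵐ ω ∂μ, ContinuousOn (fun t => J t ω) (Ico 0 1)) ∧
  ∀ t ∈ Ico (0 : ℝ) 1, ∃ I, IsForwardIntegral μ 1 (truncAt t Y) X I ∧
    ∀ᵐ ω ∂μ, ∀ s ∈ Icc 0 t, J s ω = I s ω

/-- `Y` is `X`-improperly forward integrable on `[0,1]`. -/
def ImproperlyForwardIntegrable [MeasurableSpace Ω] (μ : Measure Ω) (Y X : ℝ → Ω → ℝ) : Prop :=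
  ∃ J, IsLocalForwardIntegral μ Y X J ∧
    ∀ᵐ ω ∂μ, ∃ l : ℝ, Tendsto (fun t => J t ω) (𝓝[<] 1) (𝓝 l)

/-- `h` belongs to `C_b^-([0,1))`: its paths are left continuous and bounded on each compact
subset of `[0,1)`. -/
def HasLeftContBddPaths [MeasurableSpace Ω] (μ : Measure Ω) (h : ℝ → Ω → ℝ) : Prop :=
  ∀ᵐ ω ∂μ,
    (∀ t ∈ Ico (0 : ℝ) 1, ContinuousWithinAt (fun s => h s ω) (Ico 0 t) t) ∧
    ∀ k : Set ℝ, IsCompact k → k ⊆ Ico 0 1 → Bornology.IsBounded ((fun s => h s ω) '' k)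

/-- The usual conditions for a filtration on `[0,1]`: right continuity, and every null set belongs
to the initial sigma-algebra. -/
def UsualConditions {m : MeasurableSpace Ω} (μ : Measure Ω)
    (𝒢 : Filtration unitInterval m) : Prop :=
  𝒢.IsRightContinuous ∧ ∀ s : Set Ω, μ s = 0 → MeasurableSet[𝒢 0] s

/-- The pair `(X₀,h)` is a self-financing portfolio for the stock price `S`. -/
structure IsSelfFinancingPortfolio {m : MeasurableSpace Ω} (μ : Measure Ω)
    (𝒢 : Filtration unitInterval m) (S : ℝ → Ω → ℝ) (X₀ : Ω → ℝ) (h : ℝ → Ω → ℝ) : Prop where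
  measurable_initial : Measurable[𝒢 0] X₀
  adapted : ∀ t : unitInterval, (t : ℝ) < 1 → Measurable[𝒢 t] (h t)
  paths : HasLeftContBddPaths μ h
  integrable : LocallyForwardIntegrable μ h S

/-- `X` is the wealth process on `[0,1)` of the portfolio `(X₀,h)` when the price of the less risky
asset is `S⁰_t = exp(V_t)` with `V_t = r t`:
`exp(-V_t) X_t = X₀ - ∫₀ᵗ exp(-V_s) h_s S_s dV_s + ∫₀ᵗ exp(-V_s) d⁻(∫₀ˢ h d⁻S)`.
Here `J` is the local forward integral of `h` with respect to `S`, and `W` that of `exp(-V)` with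
respect to `J`; as `J` lives on `[0,1)`, the latter is taken on `[0,T]` for each `T < 1`. -/
def IsWealthProcess [MeasurableSpace Ω] (μ : Measure Ω) (r : ℝ) (S : ℝ → Ω → ℝ)
    (X₀ : Ω → ℝ) (h X : ℝ → Ω → ℝ) : Prop :=
  ∃ J W : ℝ → Ω → ℝ,
    IsLocalForwardIntegral μ h S J ∧
    (∀ T ∈ Ico (0 : ℝ) 1, IsForwardIntegral μ T (fun t _ => Real.exp (-(r * t))) J W) ∧
    ∀ᵐ ω ∂μ, ∀ t ∈ Ico (0 : ℝ) 1,
      Real.exp (-(r * t)) * X t ω =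
        X₀ ω - (∫ s in (0 : ℝ)..t, Real.exp (-(r * s)) * h s ω * S s ω * r) + W t ω

/-- The portfolio `(X₀,h)` replicates the claim `C`: `h` is improperly `S`-forward integrable and
the wealth process tends to `C` at time `1`, almost surely. -/
def Replicates [MeasurableSpace Ω] (μ : Measure Ω) (r : ℝ) (S : ℝ → Ω → ℝ)
    (X₀ : Ω → ℝ) (h : ℝ → Ω → ℝ) (C : Ω → ℝ) : Prop :=
  ImproperlyForwardIntegrable μ h S ∧
  ∃ X, IsWealthProcess μ r S X₀ h X ∧
    ∀ᵐ ω ∂μ, Tendsto (fun t => X t ω) (𝓝[<] 1) (𝓝 (C ω))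

/-- The time derivative on `[0,1)` (one-sided at `0`). -/
def timeDeriv (v : ℝ → ℝ → ℝ) (t y : ℝ) : ℝ :=
  derivWithin (fun s => v s y) (Ico 0 1) t

/-- `v` is of class `C^{1,2}` on `[0,1) × ℝ`. -/
structure IsC12 (v : ℝ → ℝ → ℝ) : Prop where
  time_diff : ∀ t ∈ Ico (0 : ℝ) 1, ∀ y,
    DifferentiableWithinAt ℝ (fun s => v s y) (Ico 0 1) t
  space_diff : ∀ t ∈ Ico (0 : ℝ) 1, ContDiff ℝ 2 (v t)
  time_cont : ContinuousOn (fun p : ℝ × ℝ => timeDeriv v p.1 p.2) (Ico 0 1 ×ˢ univ)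
  space_cont : ContinuousOn (fun p : ℝ × ℝ => deriv (v p.1) p.2) (Ico 0 1 ×ˢ univ)
  space_cont₂ : ContinuousOn (fun p : ℝ × ℝ => iteratedDeriv 2 (v p.1) p.2) (Ico 0 1 ×ˢ univ)

/-- `Z_t = ∫₀ᵗ S_s ds - K`. -/
def asianZ (S : ℝ → Ω → ℝ) (K t : ℝ) (ω : Ω) : ℝ :=
  (∫ s in (0 : ℝ)..t, S s ω) - K

/-- `h_t = v(t, Z_t/S_t) - ∂_y v(t, Z_t/S_t) Z_t/S_t`. -/
def asianHedge (v : ℝ → ℝ → ℝ) (S : ℝ → Ω → ℝ) (K t : ℝ) (ω : Ω) : ℝ :=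
  v t (asianZ S K t ω / S t ω)
    - deriv (v t) (asianZ S K t ω / S t ω) * (asianZ S K t ω / S t ω)

end

/-! Put Y = Z/S and F_t = v(t, Y_t) S_t. The wealth process of the portfolio is F itself: it starts
at X₀, and continuity of v up to time 1 gives it the claim as limit. It remains to identify the gain
∫ h d⁻S and to show that it converges at maturity.

For the gain the argument is pathwise and uses no semimartingale property. Since Z is C¹, S_{s+ε} ΔY
= ΔZ − Y_s ΔS, and a second order Taylor expansion of v shows that ΔF equals h ΔS plus ε S (∂_t v +
∂_y v) plus ½ ∂_yy v Y² (ΔS)² / S, up to o(ε + (ΔS)²) (`wealthPath_increment`,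
`hedgePath_remainder`). Along a sequence ε → 0 on which the quadratic variation converges almost
surely, the measures ε⁻¹ (ΔS)² ds converge weakly to σ² S² ds, and the equation for v collapses the
drift to r Z ∂_y v. Thus ∫₀ᵗ h d⁻S = F_t − F_0 − r ∫₀ᵗ Z ∂_y v ds, which is `gainPath`
(`tendsto_forward_hedgePath`). As hS = F − Z ∂_y v, an integration by parts gives the wealth
equation (`discounted_wealthPath`).

The analytic difficulty is convergence at time 1: ψ is merely continuous, so ∂_y v may explode, and
the equation degenerates at y = 0. A two-point maximum principle (doubling of variables) applied on
a ball of radius |y|/2 about y yields |y ∂_y v| ≤ C / √(1 − t) for c(1 − t) ≤ |y| ≤ R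
(`exists_weighted_gradient_bound`). The path Y remains in such a region near maturity: either Z_1 ≠
0, or Z_t = −∫_t^1 S is of exact order 1 − t. Hence Z ∂_y v = S · Y ∂_y v has an integrable
singularity. -/

/-! ### Interior gradient bounds by the two-point maximum principle. -/

/-- A positive second derivative would make x a local minimum as well, hence f locally constant with
vanishing second derivative. -/
theorem IsLocalMax.iteratedDeriv_two_nonpos {f : ℝ → ℝ} {x : ℝ} (h : IsLocalMax f x)
    (hf : ContinuousAt f x) : iteratedDeriv 2 f x ≤ 0 := by
  by_contra! hpos
  rw [iteratedDeriv_succ, iteratedDeriv_one] at hpos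
  have hmin := isLocalMin_of_deriv_deriv_pos hpos h.deriv_eq_zero hf
  have heq : f =ᶠ[𝓝 x] fun _ => f x := by
    filter_upwards [h, hmin] with y h₁ h₂ using le_antisymm h₁ h₂
  have h0 := heq.deriv.deriv_eq
  simp at h0
  linarith

/-- Only later times are compared, because the space-time maximum may lie on the initial face of the
cylinder. -/
theorem derivWithin_Ico_nonpos_of_forall_le {f : ℝ → ℝ} {a b t : ℝ} (hat : t ∈ Ico a b)
    (hf : DifferentiableWithinAt ℝ f (Ico a b) t) (h : ∀ᶠ s in 𝓝[>] t, f s ≤ f t) :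
    derivWithin f (Ico a b) t ≤ 0 := by
  have h1 := hf.hasDerivWithinAt.mono (s := Ioo t b)
    (fun s hs => ⟨hat.1.trans hs.1.le, hs.2⟩)
  rw [hasDerivWithinAt_iff_tendsto_slope' (by simp)] at h1
  rw [nhdsWithin_Ioo_eq_nhdsGT hat.2] at h1
  refine le_of_tendsto h1 ?_
  filter_upwards [h, self_mem_nhdsWithin] with s hs hts
  rw [slope_def_field]
  exact div_nonpos_of_nonpos_of_nonneg (by linarith) (by simpa using le_of_lt hts)

/-- First and second order conditions for a one-variable slice. -/
theorem quadratic_touch {f : ℝ → ℝ} (hf : ContDiff ℝ 2 f) {x p q c : ℝ}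
    (h : IsLocalMax (fun z => f z - (c * (z - x) ^ 2 + p * (z - x) + q)) x) :
    deriv f x = p ∧ iteratedDeriv 2 f x ≤ 2 * c := by
  have hd : ∀ z, HasDerivAt (fun z => f z - (c * (z - x) ^ 2 + p * (z - x) + q))
      (deriv f z - (2 * c * (z - x) + p)) z := by
    intro z
    have h1 : HasDerivAt f (deriv f z) z := (hf.differentiable (by norm_num) z).hasDerivAt
    have h2 : HasDerivAt (fun z => c * (z - x) ^ 2 + p * (z - x) + q)
        (2 * c * (z - x) + p) z := by
      have h3 := (hasDerivAt_id' z).sub_const x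
      refine ((((h3.fun_pow 2).const_mul c).add (h3.const_mul p)).add_const q).congr_deriv ?_
      norm_num
      ring
    exact h1.sub h2
  have hdf : Differentiable ℝ (deriv f) := hf.differentiable_deriv_two
  constructor
  · have := h.hasDerivAt_eq_zero (hd x)
    simp at this
    linarith
  · have h2 := h.iteratedDeriv_two_nonpos (hd x).continuousAt
    rw [iteratedDeriv_succ, iteratedDeriv_one, funext fun z => (hd z).deriv] at h2
    have h4 : HasDerivAt (fun z => deriv f z - (2 * c * (z - x) + p))
        (deriv (deriv f) x - 2 * c) x := by
      refine (hdf x).hasDerivAt.sub ?_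
      refine ((((hasDerivAt_id' x).sub_const x).const_mul (2 * c)).add_const p).congr_deriv ?_
      ring
    rw [h4.deriv] at h2
    rw [iteratedDeriv_succ, iteratedDeriv_one]
    linarith

/-- The two-point barrier is a strict supersolution. -/
theorem two_point_barrier_neg {σ r θ y₀ ρ M D q a b ξ η : ℝ} (hr : 0 ≤ r) (hρ : 0 < ρ)
    (hy₀ : |y₀| = ρ) (hM : 0 < M) (hb : b = 8 * M / ρ ^ 2) (hq : 0 ≤ q)
    (hD : ∀ y, |y - y₀| ≤ ρ / 2 → |1 - r * y| ≤ D)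
    (hqlarge : 8 * M / θ + 36 * M * σ ^ 2 + 16 * D * M / ρ < q * σ ^ 2 * ρ ^ 2 / 2)
    (hξa : |ξ - y₀| ≤ ρ / 2) (hηa : |η - y₀| ≤ ρ / 2) (hz0 : 0 ≤ ξ - η)
    (hz2 : 0 ≤ a - 2 * q * (ξ - η)) :
    8 * M / θ + (1 / 2 * σ ^ 2 * ξ ^ 2 * (2 * (b - q)) + 1 / 2 * σ ^ 2 * η ^ 2 *
      (2 * (b - q))) + (1 - r * ξ) * (2 * b * (ξ - y₀)) + (1 - r * η) * (2 * b * (η - y₀))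
      - r * ((ξ - η) * (a - 2 * q * (ξ - η))) < 0 := by
  have hb0 : 0 < b := by rw [hb]; positivity
  have hbρ : b * ρ ^ 2 = 8 * M := by rw [hb]; field_simp
  -- Since |y₀| = ρ, the diffusion coefficient on this ball is comparable to ρ². The lower bound
  -- lets the concavity q dominate; the upper bound controls the localisation term b.
  have hsq : ∀ w, |w - y₀| ≤ ρ / 2 → ρ ^ 2 / 4 ≤ w ^ 2 ∧ w ^ 2 ≤ 9 / 4 * ρ ^ 2 := by
    intro w hw
    have h1 : ρ - ρ / 2 ≤ |w| := by
      have := abs_sub_abs_le_abs_sub y₀ w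
      rw [abs_sub_comm] at this; linarith
    have h2 : |w| ≤ ρ + ρ / 2 := by
      have := abs_sub_abs_le_abs_sub w y₀
      linarith
    rw [← sq_abs w]
    constructor
    · calc ρ ^ 2 / 4 = (ρ / 2) ^ 2 := by ring
        _ ≤ |w| ^ 2 := by gcongr; linarith
    · calc |w| ^ 2 ≤ (3 / 2 * ρ) ^ 2 := by gcongr; linarith
        _ = _ := by ring
  have sξ := hsq ξ hξa
  have sη := hsq η hηa
  have dr : ∀ w, |w - y₀| ≤ ρ / 2 → (1 - r * w) * (2 * b * (w - y₀)) ≤ 8 * D * M / ρ := by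
    intro w hw
    have h1 : |(1 - r * w) * (w - y₀)| ≤ D * (ρ / 2) := by
      rw [abs_mul]
      exact mul_le_mul (hD w hw) hw (abs_nonneg _) ((abs_nonneg _).trans (hD w hw))
    have h2 := (le_abs_self _).trans h1
    calc (1 - r * w) * (2 * b * (w - y₀)) = 2 * b * ((1 - r * w) * (w - y₀)) := by ring
      _ ≤ 2 * b * (D * (ρ / 2)) := by gcongr
      _ = 8 * D * M / ρ := by rw [hb]; field_simp
  have dξ := dr ξ hξa
  have dη := dr η hηa
  have hrz : 0 ≤ r * ((ξ - η) * (a - 2 * q * (ξ - η))) := by positivity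
  have hs1 : σ ^ 2 * (ξ ^ 2 + η ^ 2) * b ≤ 36 * M * σ ^ 2 := by
    have h1 : (ξ ^ 2 + η ^ 2) * b ≤ (9 / 2 * ρ ^ 2) * b := by gcongr; linarith
    have h2 : (9 / 2 * ρ ^ 2) * b = 36 * M := by linear_combination 9 / 2 * hbρ
    calc σ ^ 2 * (ξ ^ 2 + η ^ 2) * b = σ ^ 2 * ((ξ ^ 2 + η ^ 2) * b) := by ring
      _ ≤ σ ^ 2 * (36 * M) := mul_le_mul_of_nonneg_left (h1.trans h2.le) (sq_nonneg σ)
      _ = _ := by ring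
  have hs2 : q * σ ^ 2 * ρ ^ 2 / 2 ≤ q * σ ^ 2 * (ξ ^ 2 + η ^ 2) := by
    have h0 : 0 ≤ q * σ ^ 2 := by positivity
    calc q * σ ^ 2 * ρ ^ 2 / 2 = q * σ ^ 2 * (ρ ^ 2 / 2) := by ring
      _ ≤ _ := by gcongr; linarith
  have h16 : 16 * D * M / ρ = 8 * D * M / ρ + 8 * D * M / ρ := by ring
  rw [h16] at hqlarge
  have hsplit : 1 / 2 * σ ^ 2 * ξ ^ 2 * (2 * (b - q)) + 1 / 2 * σ ^ 2 * η ^ 2 * (2 * (b - q))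
      = σ ^ 2 * (ξ ^ 2 + η ^ 2) * b - q * σ ^ 2 * (ξ ^ 2 + η ^ 2) := by ring
  linarith

/-- Two-point comparison for solutions of the pricing equation. -/
theorem two_point_estimate {v : ℝ → ℝ → ℝ} (hv : IsC12 v)
    (hcont : ContinuousOn (fun p : ℝ × ℝ => v p.1 p.2) (Icc 0 1 ×ˢ univ))
    {σ r : ℝ} (hr : 0 ≤ r)
    (hpde : ∀ t ∈ Ico (0 : ℝ) 1, ∀ y : ℝ,
      1 / 2 * σ ^ 2 * y ^ 2 * iteratedDeriv 2 (v t) y + (1 - r * y) * deriv (v t) y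
        + timeDeriv v t y = 0)
    {t₀ θ y₀ ρ M D q z₁ : ℝ} (ht₀ : 0 ≤ t₀) (hθ : 0 < θ) (ht₁ : t₀ + θ < 1) (hρ : 0 < ρ)
    (hy₀ : |y₀| = ρ) (hM : 0 < M) (hz₁ : 0 < z₁) (hq : 0 ≤ q)
    (hbound : ∀ t ∈ Icc t₀ (t₀ + θ), ∀ y, |y - y₀| ≤ ρ / 2 → |v t y| ≤ M)
    (hD : ∀ y, |y - y₀| ≤ ρ / 2 → |1 - r * y| ≤ D)
    (hqlarge : 8 * M / θ + 36 * M * σ ^ 2 + 16 * D * M / ρ < q * σ ^ 2 * ρ ^ 2 / 2)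
    {x y : ℝ} (hx : |x - y₀| ≤ ρ / 2) (hy : |y - y₀| ≤ ρ / 2) (hxy : 0 ≤ x - y)
    (hxyz : x - y ≤ z₁) :
    v t₀ x - v t₀ y ≤ (2 * q * z₁ + 2 * M / z₁) * (x - y) - q * (x - y) ^ 2
      + 8 * M / ρ ^ 2 * ((x - y₀) ^ 2 + (y - y₀) ^ 2) := by
  set a := 2 * q * z₁ + 2 * M / z₁ with ha
  -- The profile a z − q z² is nondecreasing on [0, z₁] and reaches at least 2M, the largest
  -- possible difference of values of v, at z = z₁.
  have haz : a * z₁ = 2 * q * z₁ ^ 2 + 2 * M := by rw [ha]; field_simp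
  have ha2 : 2 * q * z₁ ≤ a := by rw [ha]; have : 0 ≤ 2 * M / z₁ := by positivity
                                  linarith
  set b := 8 * M / ρ ^ 2 with hb
  have hb0 : 0 < b := by positivity
  have hbρ : b * ρ ^ 2 = 8 * M := by rw [hb]; field_simp
  -- The barrier adds to this concave profile a lateral penalty, equal to 2M when one point is at
  -- distance ρ/2 from y₀, and a time penalty, equal to 8M at t₀ + θ. A positive maximum of v(x) −
  -- v(y) − Φ therefore avoids every face except t = t₀.
  set Φ : ℝ → ℝ → ℝ → ℝ := fun t x y => a * (x - y) - q * (x - y) ^ 2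
      + b * ((x - y₀) ^ 2 + (y - y₀) ^ 2) + 8 * M / θ * (t - t₀) with hΦ
  let Kset : Set (ℝ × ℝ × ℝ) := (Icc t₀ (t₀ + θ) ×ˢ (Icc (y₀ - ρ / 2) (y₀ + ρ / 2) ×ˢ
    Icc (y₀ - ρ / 2) (y₀ + ρ / 2))) ∩ {p | 0 ≤ p.2.1 - p.2.2 ∧ p.2.1 - p.2.2 ≤ z₁}
  have hK : IsCompact Kset := by
    refine (isCompact_Icc.prod (isCompact_Icc.prod isCompact_Icc)).inter_right ?_
    have hc : Continuous fun p : ℝ × ℝ × ℝ => p.2.1 - p.2.2 := by fun_prop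
    exact (isClosed_le continuous_const hc).inter (isClosed_le hc continuous_const)
  have hfc : ContinuousOn (fun p : ℝ × ℝ × ℝ => v p.1 p.2.1 - v p.1 p.2.2 - Φ p.1 p.2.1 p.2.2)
      Kset := by
    have h1 : ContinuousOn (fun p : ℝ × ℝ × ℝ => v p.1 p.2.1) Kset :=
      hcont.comp (f := fun p : ℝ × ℝ × ℝ => (p.1, p.2.1)) (by fun_prop)
        (fun p hp => ⟨⟨ht₀.trans hp.1.1.1, by linarith [hp.1.1.2]⟩, mem_univ _⟩)
    have h2 : ContinuousOn (fun p : ℝ × ℝ × ℝ => v p.1 p.2.2) Kset :=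
      hcont.comp (f := fun p : ℝ × ℝ × ℝ => (p.1, p.2.2)) (by fun_prop)
        (fun p hp => ⟨⟨ht₀.trans hp.1.1.1, by linarith [hp.1.1.2]⟩, mem_univ _⟩)
    refine (h1.sub h2).sub ?_
    simp only [hΦ]
    fun_prop
  have hmem : (t₀, x, y) ∈ Kset := by
    rw [abs_le] at hx hy
    exact ⟨⟨⟨le_rfl, by linarith⟩, ⟨by linarith, by linarith⟩, ⟨by linarith, by linarith⟩⟩,
      hxy, hxyz⟩
  obtain ⟨⟨t, ξ, η⟩, hpK, hmax⟩ := hK.exists_isMaxOn ⟨_, hmem⟩ hfc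
  have hmax' : ∀ t' ξ' η', (t', ξ', η') ∈ Kset →
      v t' ξ' - v t' η' - Φ t' ξ' η' ≤ v t ξ - v t η - Φ t ξ η := fun t' ξ' η' h => hmax h
  suffices hs : v t ξ - v t η - Φ t ξ η ≤ 0 by
    have := (hmax' _ _ _ hmem).trans hs
    simp only [hΦ, sub_self, mul_zero, add_zero] at this
    linarith
  by_contra! hpos
  obtain ⟨⟨⟨ht1, ht2⟩, ⟨hξ1, hξ2⟩, hη1, hη2⟩, hz0, hz1⟩ := hpK
  simp only at ht1 ht2 hξ1 hξ2 hη1 hη2 hz0 hz1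
  have hξa : |ξ - y₀| ≤ ρ / 2 := abs_le.2 ⟨by linarith, by linarith⟩
  have hηa : |η - y₀| ≤ ρ / 2 := abs_le.2 ⟨by linarith, by linarith⟩
  have hvξ := abs_le.1 (hbound t ⟨ht1, ht2⟩ ξ hξa)
  have hvη := abs_le.1 (hbound t ⟨ht1, ht2⟩ η hηa)
  have hT0 : 0 ≤ 8 * M / θ * (t - t₀) := by
    have : 0 ≤ t - t₀ := by linarith
    positivity
  have hB0 : 0 ≤ b * ((ξ - y₀) ^ 2 + (η - y₀) ^ 2) := by positivity
  have hφ0 : 0 ≤ a * (ξ - η) - q * (ξ - η) ^ 2 := by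
    linear_combination mul_nonneg (mul_nonneg hq hz0) hz0
      + 2 * mul_nonneg (mul_nonneg hq hz0) (sub_nonneg.2 hz1)
      + mul_le_mul_of_nonneg_right ha2 hz0
  have hΦpos : Φ t ξ η < 2 * M := by linarith
  simp only [hΦ] at hΦpos
  -- the maximum is attained in the interior
  have hz0' : 0 < ξ - η := by
    rcases hz0.lt_or_eq with h | h
    · exact h
    · have hξη : ξ = η := by linarith
      subst hξη
      have : 0 ≤ Φ t ξ ξ := by simp only [hΦ]; linarith
      linarith
  have hz1' : ξ - η < z₁ := by
    rcases hz1.lt_or_eq with h | h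
    · exact h
    · rw [h, haz] at hΦpos
      linarith [mul_nonneg hq (sq_nonneg z₁)]
  have ht2' : t < t₀ + θ := by
    rcases ht2.lt_or_eq with h | h
    · exact h
    · have : 8 * M / θ * (t - t₀) = 8 * M := by rw [h]; field_simp; ring
      linarith
  have hlat : ∀ w, |w - y₀| ≤ ρ / 2 → b * (w - y₀) ^ 2 < 2 * M → |w - y₀| < ρ / 2 := by
    intro w hw hw2
    rcases hw.lt_or_eq with h | h
    · exact h
    · rw [← sq_abs, h] at hw2
      have : b * (ρ / 2) ^ 2 = 2 * M := by linear_combination hbρ / 4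
      linarith
  have hξ' := abs_lt.1 (hlat ξ hξa (by linarith [mul_nonneg hb0.le (sq_nonneg (η - y₀))]))
  have hη' := abs_lt.1 (hlat η hηa (by linarith [mul_nonneg hb0.le (sq_nonneg (ξ - y₀))]))
  have htI : t ∈ Ico (0 : ℝ) 1 := ⟨by linarith, by linarith⟩
  -- derivative conditions
  have hX : IsLocalMax (fun z => v t z - ((b - q) * (z - ξ) ^ 2
      + (a - 2 * q * (ξ - η) + 2 * b * (ξ - y₀)) * (z - ξ) + (v t η + Φ t ξ η))) ξ := by
    have hn : ∀ᶠ z in 𝓝 ξ, z ∈ Ioo (max (y₀ - ρ / 2) η) (min (y₀ + ρ / 2) (η + z₁)) :=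
      Ioo_mem_nhds (max_lt (by linarith) (by linarith)) (lt_min (by linarith) (by linarith))
    filter_upwards [hn] with z hz
    have h1 := (max_lt_iff.1 hz.1)
    have h2 := (lt_min_iff.1 hz.2)
    have := hmax' t z η ⟨⟨⟨ht1, ht2⟩, ⟨h1.1.le, h2.1.le⟩, hη1, hη2⟩,
      by simp only; linarith, by simp only; linarith⟩
    simp only [hΦ] at this ⊢
    linear_combination this
  have hY : IsLocalMax (fun z => -v t z - ((b - q) * (z - η) ^ 2
      + (-(a - 2 * q * (ξ - η)) + 2 * b * (η - y₀)) * (z - η) + (- v t ξ + Φ t ξ η))) η := by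
    have hn : ∀ᶠ z in 𝓝 η, z ∈ Ioo (max (y₀ - ρ / 2) (ξ - z₁)) (min (y₀ + ρ / 2) ξ) :=
      Ioo_mem_nhds (max_lt (by linarith) (by linarith)) (lt_min (by linarith) (by linarith))
    filter_upwards [hn] with z hz
    have h1 := (max_lt_iff.1 hz.1)
    have h2 := (lt_min_iff.1 hz.2)
    have := hmax' t ξ z ⟨⟨⟨ht1, ht2⟩, ⟨hξ1, hξ2⟩, ⟨h1.1.le, h2.1.le⟩⟩,
      by simp only; linarith, by simp only; linarith⟩
    simp only [hΦ] at this ⊢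
    linear_combination this
  obtain ⟨hX1, hX2⟩ := quadratic_touch (hv.space_diff t htI) hX
  obtain ⟨hY1, hY2⟩ := quadratic_touch (f := fun z => - v t z) (hv.space_diff t htI).neg hY
  rw [deriv.fun_neg] at hY1
  rw [show (fun z => - v t z) = - v t from rfl, iteratedDeriv_neg] at hY2
  have hT : timeDeriv v t ξ - timeDeriv v t η ≤ 8 * M / θ := by
    have hd1 := hv.time_diff t htI ξ
    have hd2 := hv.time_diff t htI η
    have hu : UniqueDiffWithinAt ℝ (Ico (0 : ℝ) 1) t := uniqueDiffOn_Ico 0 1 t htI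
    have hd3 : HasDerivWithinAt (fun s => v s ξ - v s η - 8 * M / θ * (s - t))
        (timeDeriv v t ξ - timeDeriv v t η - 8 * M / θ) (Ico 0 1) t := by
      refine (hd1.hasDerivWithinAt.sub hd2.hasDerivWithinAt).sub ?_
      simpa using (((hasDerivAt_id t).sub_const t).const_mul (8 * M / θ)).hasDerivWithinAt
    have := derivWithin_Ico_nonpos_of_forall_le htI hd3.differentiableWithinAt (by
      have hn : ∀ᶠ s in 𝓝[>] t, s ∈ Ioo t (t₀ + θ) := Ioo_mem_nhdsGT ht2'
      filter_upwards [hn] with s hs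
      have := hmax' s ξ η ⟨⟨⟨ht1.trans hs.1.le, hs.2.le⟩, ⟨hξ1, hξ2⟩, hη1, hη2⟩, hz0, hz1⟩
      simp only [hΦ] at this ⊢
      linear_combination this)
    rw [hd3.derivWithin hu] at this
    linarith
  have e1 := hpde t htI ξ
  have e2 := hpde t htI η
  have hσξ : 0 ≤ 1 / 2 * σ ^ 2 * ξ ^ 2 := by positivity
  have hση : 0 ≤ 1 / 2 * σ ^ 2 * η ^ 2 := by positivity
  have k1 := mul_le_mul_of_nonneg_left hX2 hσξ
  have k2 := mul_le_mul_of_nonneg_left hY2 hση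
  have hY1' : deriv (v t) η = (a - 2 * q * (ξ - η)) - 2 * b * (η - y₀) := by linarith
  rw [hX1] at e1
  rw [hY1'] at e2
  -- The profile has nonnegative slope, so the difference of its two drift contributions, −r(ξ − η)
  -- times the slope, has a favourable sign.
  have hz2 : 0 ≤ a - 2 * q * (ξ - η) := by
    linear_combination ha2 + 2 * mul_nonneg hq (sub_nonneg.2 hz1)
  -- Subtracting the equations at ξ and η and inserting the derivative conditions makes the barrier
  -- expression nonnegative, against strict supersolution.
  refine absurd (two_point_barrier_neg hr hρ hy₀ hM hb hq hD hqlarge hξa hηa hz0 hz2) ?_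
  rw [not_lt]
  linear_combination hT + k1 + k2 - e1 + e2

/-- Take y = y₀ and x = y₀ + δ in the two-point estimate and divide by δ: the lateral penalty is
quadratic in δ and disappears in the limit. -/
theorem deriv_le_of_two_point {v : ℝ → ℝ → ℝ} (hv : IsC12 v)
    (hcont : ContinuousOn (fun p : ℝ × ℝ => v p.1 p.2) (Icc 0 1 ×ˢ univ))
    {σ r : ℝ} (hr : 0 ≤ r)
    (hpde : ∀ t ∈ Ico (0 : ℝ) 1, ∀ y : ℝ,
      1 / 2 * σ ^ 2 * y ^ 2 * iteratedDeriv 2 (v t) y + (1 - r * y) * deriv (v t) y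
        + timeDeriv v t y = 0)
    {t₀ θ y₀ ρ M D q z₁ : ℝ} (ht₀ : 0 ≤ t₀) (hθ : 0 < θ) (ht₁ : t₀ + θ < 1) (hρ : 0 < ρ)
    (hy₀ : |y₀| = ρ) (hM : 0 < M) (hz₁ : 0 < z₁) (hq : 0 ≤ q)
    (hbound : ∀ t ∈ Icc t₀ (t₀ + θ), ∀ y, |y - y₀| ≤ ρ / 2 → |v t y| ≤ M)
    (hD : ∀ y, |y - y₀| ≤ ρ / 2 → |1 - r * y| ≤ D)
    (hqlarge : 8 * M / θ + 36 * M * σ ^ 2 + 16 * D * M / ρ < q * σ ^ 2 * ρ ^ 2 / 2) :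
    deriv (v t₀) y₀ ≤ 2 * q * z₁ + 2 * M / z₁ := by
  have hd : HasDerivAt (v t₀) (deriv (v t₀) y₀) y₀ :=
    ((hv.space_diff t₀ ⟨ht₀, by linarith⟩).differentiable (by norm_num) y₀).hasDerivAt
  have h1 : HasDerivAt (fun δ => v t₀ (y₀ + δ) - v t₀ y₀) (deriv (v t₀) y₀) 0 := by
    have : HasDerivAt (v t₀) (deriv (v t₀) y₀) (y₀ + 0) := by simpa using hd
    simpa using (this.comp_const_add y₀ 0).sub_const (v t₀ y₀)
  have h2 := (hasDerivAt_iff_tendsto_slope_zero.1 h1).mono_left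
    (nhdsWithin_mono 0 (fun x (hx : x ∈ Ioi (0 : ℝ)) => (ne_of_gt hx)))
  set a := 2 * q * z₁ + 2 * M / z₁ with ha
  have h3 : Tendsto (fun δ : ℝ => a + 8 * M / ρ ^ 2 * δ) (𝓝[>] 0) (𝓝 a) := by
    have : ContinuousAt (fun δ : ℝ => a + 8 * M / ρ ^ 2 * δ) 0 := by fun_prop
    simpa using this.tendsto.mono_left nhdsWithin_le_nhds
  refine le_of_tendsto_of_tendsto h2 h3 ?_
  have hn : ∀ᶠ δ : ℝ in 𝓝[>] 0, δ ∈ Ioo 0 (min (ρ / 2) z₁) :=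
    Ioo_mem_nhdsGT (lt_min (by linarith) hz₁)
  filter_upwards [hn] with δ hδ
  have hδ2 := lt_min_iff.1 hδ.2
  have hδ0 : 0 < δ := hδ.1
  have := two_point_estimate hv hcont hr hpde ht₀ hθ ht₁ hρ hy₀ hM hz₁ hq hbound hD hqlarge
    (x := y₀ + δ) (y := y₀) (by rw [add_sub_cancel_left, abs_of_pos hδ0]; exact hδ2.1.le)
    (by simp; positivity) (by simpa using hδ0.le) (by simpa using hδ2.2.le)
  simp only [add_sub_cancel_left, sub_self, zero_add, add_zero, smul_eq_mul] at this ⊢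
  rw [inv_mul_le_iff₀ hδ0]
  nlinarith [mul_nonneg hq (sq_nonneg δ)]

theorem timeDeriv_neg (v : ℝ → ℝ → ℝ) (t y : ℝ) :
    timeDeriv (fun s z => -v s z) t y = -timeDeriv v t y := by
  simp only [timeDeriv]
  exact derivWithin.fun_neg

theorem IsC12.neg {v : ℝ → ℝ → ℝ} (hv : IsC12 v) : IsC12 (fun t y => -v t y) where
  time_diff t ht y := (hv.time_diff t ht y).neg
  space_diff t ht := (hv.space_diff t ht).neg
  time_cont := by simpa only [timeDeriv_neg] using hv.time_cont.fun_neg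
  space_cont := by simpa only [deriv.fun_neg] using hv.space_cont.fun_neg
  space_cont₂ := by
    have : ∀ t y, iteratedDeriv 2 (fun z => - v t z) y = - iteratedDeriv 2 (v t) y :=
      fun t y => iteratedDeriv_neg 2 (v t) y
    simpa only [this] using hv.space_cont₂.fun_neg

/-- Diffusion acts at scale |y|√(1 − t) in space over a time of order 1 − t. The condition c(1 − t)
≤ |y| keeps the drift, of relative size 1/|y|, within the same order 1/(1 − t). -/
theorem weighted_deriv_le {v : ℝ → ℝ → ℝ} (hv : IsC12 v)
    (hcont : ContinuousOn (fun p : ℝ × ℝ => v p.1 p.2) (Icc 0 1 ×ˢ univ))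
    {σ r : ℝ} (hr : 0 ≤ r) (hσ : 0 < σ)
    (hpde : ∀ t ∈ Ico (0 : ℝ) 1, ∀ y : ℝ,
      1 / 2 * σ ^ 2 * y ^ 2 * iteratedDeriv 2 (v t) y + (1 - r * y) * deriv (v t) y
        + timeDeriv v t y = 0)
    {c R M : ℝ} (hc : 0 < c) (hR : 0 < R) (hM : 0 < M)
    (hbound : ∀ t ∈ Icc (0 : ℝ) 1, ∀ y, |y| ≤ 2 * R → |v t y| ≤ M)
    {t y : ℝ} (ht : t ∈ Ico (0 : ℝ) 1) (hcy : c * (1 - t) ≤ |y|) (hyR : |y| ≤ R) :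
    |y| * deriv (v t) y ≤
      (16 * (8 * M + 36 * M * σ ^ 2 + 8 * (1 + 2 * r * R) * M / c) / σ ^ 2 + 2 * M)
        / √(1 - t) := by
  set D := 1 + 2 * r * R with hD
  set E := 8 * M + 36 * M * σ ^ 2 + 8 * D * M / c with hE
  have hD0 : 0 < D := by positivity
  have hE0 : 0 < E := by positivity
  have hτ : 0 < 1 - t := by linarith [ht.2]
  set ρ := |y| with hρ
  have hρ0 : 0 < ρ := (mul_pos hc hτ).trans_le hcy
  set s := √(1 - t) with hs
  have hs0 : 0 < s := Real.sqrt_pos.2 hτ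
  have hss : 1 - t = s ^ 2 := (Real.sq_sqrt hτ.le).symm
  have hnear : ∀ w, |w - y| ≤ ρ / 2 → |w| ≤ 2 * R := fun w hw => by
    have := abs_sub_abs_le_abs_sub w y
    linarith
  -- The constant q makes q σ² ρ² / 2 = 4E/(1 − t), enough to absorb all the error terms. With z₁ =
  -- ρ√(1 − t) both parts of the slope 2 q z₁ + 2M/z₁ are of order 1/(ρ√(1 − t)).
  have key := deriv_le_of_two_point hv hcont hr hpde (t₀ := t) (θ := (1 - t) / 2) (y₀ := y)
    (ρ := ρ) (M := M) (D := D) (q := 8 * E / (σ ^ 2 * ρ ^ 2 * (1 - t))) (z₁ := ρ * s)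
    ht.1 (by linarith) (by linarith) hρ0 rfl hM (by positivity) (by positivity)
    (fun u hu w hw => hbound u ⟨ht.1.trans hu.1, by linarith [hu.2]⟩ w (hnear w hw))
    (fun w hw => by
      have h1 := hnear w hw
      calc |1 - r * w| ≤ |1| + |r * w| := abs_sub _ _
        _ = 1 + r * |w| := by rw [abs_one, abs_mul, abs_of_nonneg hr]
        _ ≤ 1 + r * (2 * R) := by gcongr
        _ = D := by rw [hD]; ring)
    (by
      have e1 : 8 * E / (σ ^ 2 * ρ ^ 2 * (1 - t)) * σ ^ 2 * ρ ^ 2 / 2 = 4 * E / (1 - t) := by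
        field_simp
        ring
      have e2 : 8 * M / ((1 - t) / 2) = 2 * (8 * M) / (1 - t) := by field_simp
      have e3 : 36 * M * σ ^ 2 ≤ 36 * M * σ ^ 2 / (1 - t) := by
        rw [le_div_iff₀ hτ]
        nlinarith [show 0 < 36 * M * σ ^ 2 by positivity, ht.1]
      have e4 : 16 * D * M / ρ ≤ 16 * D * M / (c * (1 - t)) := by gcongr
      have e5 : 16 * D * M / (c * (1 - t)) = 2 * (8 * D * M / c) / (1 - t) := by
        field_simp
        ring
      have e6 : 4 * E / (1 - t) = 2 * (8 * M) / (1 - t) + 2 * (36 * M * σ ^ 2) / (1 - t)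
          + 2 * (8 * D * M / c) / (1 - t) + 2 * E / (1 - t) := by rw [hE]; ring
      have e7 : 0 < 2 * E / (1 - t) := by positivity
      have e8 : 2 * (36 * M * σ ^ 2) / (1 - t) = 2 * (36 * M * σ ^ 2 / (1 - t)) := by ring
      have e9 : 0 < 36 * M * σ ^ 2 / (1 - t) := by positivity
      rw [e1, e2, e6, e8]
      linarith)
  calc ρ * deriv (v t) y ≤ ρ * _ := mul_le_mul_of_nonneg_left key hρ0.le
    _ = (16 * E / σ ^ 2 + 2 * M) / s := by
      rw [hss]
      field_simp
      ring

/-- Weighted interior gradient bound, with an integrable singularity at the terminal time. -/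
theorem exists_weighted_gradient_bound {v : ℝ → ℝ → ℝ} (hv : IsC12 v)
    (hcont : ContinuousOn (fun p : ℝ × ℝ => v p.1 p.2) (Icc 0 1 ×ˢ univ))
    {σ r : ℝ} (hr : 0 ≤ r) (hσ : 0 < σ)
    (hpde : ∀ t ∈ Ico (0 : ℝ) 1, ∀ y : ℝ,
      1 / 2 * σ ^ 2 * y ^ 2 * iteratedDeriv 2 (v t) y + (1 - r * y) * deriv (v t) y
        + timeDeriv v t y = 0)
    {c R : ℝ} (hc : 0 < c) (hR : 0 < R) :
    ∃ C, ∀ t ∈ Ico (0 : ℝ) 1, ∀ y, c * (1 - t) ≤ |y| → |y| ≤ R →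
      |y * deriv (v t) y| ≤ C / √(1 - t) := by
  obtain ⟨M, hM⟩ := (isCompact_Icc.prod
    (isCompact_Icc (a := -(2 * R)) (b := 2 * R))).exists_bound_of_continuousOn
    (hcont.mono (prod_mono (Subset.refl (Icc (0 : ℝ) 1)) (subset_univ _)))
  have hb : ∀ t ∈ Icc (0 : ℝ) 1, ∀ y, |y| ≤ 2 * R → |v t y| ≤ max M 1 := fun t ht y hy =>
    (hM (t, y) ⟨ht, abs_le.1 hy⟩).trans (le_max_left _ _)
  have hM1 : 0 < max M 1 := lt_max_of_lt_right one_pos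
  refine ⟨16 * (8 * max M 1 + 36 * max M 1 * σ ^ 2 + 8 * (1 + 2 * r * R) * max M 1 / c) / σ ^ 2
    + 2 * max M 1, fun t ht y hcy hyR => ?_⟩
  have h1 := weighted_deriv_le hv hcont hr hσ hpde hc hR hM1 hb ht hcy hyR
  -- The equation is linear, so −v is also a solution and supplies the lower bound.
  have h2 := weighted_deriv_le hv.neg hcont.fun_neg hr hσ (fun t ht y => by
    have h3 : iteratedDeriv 2 (fun z => - v t z) y = - iteratedDeriv 2 (v t) y :=
      iteratedDeriv_neg 2 (v t) y
    rw [timeDeriv_neg, deriv.fun_neg, h3]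
    linarith [hpde t ht y]) hc hR hM1 (fun t ht y hy => by rw [abs_neg]; exact hb t ht y hy)
    ht hcy hyR
  rw [deriv.fun_neg] at h2
  rw [show |y * deriv (v t) y| = |(|y| * deriv (v t) y)| by simp [abs_mul]]
  exact abs_le.2 ⟨by linarith, h1⟩

/-! ### Limits of regularized integrals along a single path. -/

/-- Forward regularization of an exponential weight against a continuous path. -/
theorem tendsto_exp_forward_average (r : ℝ) {f : ℝ → ℝ} (hf : Continuous f) (t : ℝ) :
    Tendsto (fun ε : ℝ => ε⁻¹ * ∫ s in (0 : ℝ)..t, Real.exp (-(r * s)) * (f (s + ε) - f s))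
      (𝓝[>] 0)
      (𝓝 (Real.exp (-(r * t)) * f t - f 0 + r * ∫ s in (0 : ℝ)..t, Real.exp (-(r * s)) * f s)) := by
  set k : ℝ → ℝ := fun s => Real.exp (-(r * s)) * f s with hk
  have hkc : Continuous k := by fun_prop
  set P : ℝ → ℝ := fun x => ∫ s in (0 : ℝ)..x, k s with hP
  have hPd : ∀ x, HasDerivAt P (k x) x := fun x => hkc.integral_hasStrictDerivAt 0 x |>.hasDerivAt
  -- With k(s) = e^{−rs} f(s), one has e^{−rs} f(s + ε) = e^{rε} k(s + ε). The regularized integral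
  -- is then exactly a difference quotient of this function at ε = 0.
  have hφ : HasDerivAt (fun ε => Real.exp (r * ε) * (P (t + ε) - P (0 + ε)))
      (r * P t + (k t - k 0)) 0 := by
    have h1 : HasDerivAt (fun ε => P (t + ε)) (k t) 0 := by
      have : HasDerivAt P (k t) (t + 0) := by simpa using hPd t
      exact this.comp_const_add t 0
    have h2 : HasDerivAt (fun ε => P (0 + ε)) (k 0) 0 := by
      have : HasDerivAt P (k 0) (0 + 0) := by simpa using hPd 0
      exact this.comp_const_add 0 0
    have h3 : HasDerivAt (fun ε => Real.exp (r * ε)) r 0 := by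
      simpa using ((hasDerivAt_id' (0 : ℝ)).const_mul r).exp
    refine (h3.mul (h1.sub h2)).congr_deriv ?_
    simp [hP]
  have h4 := (hasDerivAt_iff_tendsto_slope_zero.1 hφ).mono_left
    (nhdsWithin_mono 0 (fun x (hx : x ∈ Ioi (0 : ℝ)) => (ne_of_gt hx)))
  have hlim : r * P t + (k t - k 0) = Real.exp (-(r * t)) * f t - f 0
      + r * ∫ s in (0 : ℝ)..t, Real.exp (-(r * s)) * f s := by
    simp [hP, hk]; ring
  rw [← hlim]
  refine h4.congr fun ε => ?_
  have hint : ∀ a b, IntervalIntegrable k volume a b := fun a b => hkc.intervalIntegrable a b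
  have e1 : P (t + (0 + ε)) - P (0 + (0 + ε)) = ∫ s in (0 : ℝ)..t, k (s + ε) := by
    simp only [hP, zero_add]
    rw [intervalIntegral.integral_comp_add_right,
      intervalIntegral.integral_interval_sub_left (hint _ _) (hint _ _), zero_add]
  have e2 : P (t + 0) - P (0 + 0) = ∫ s in (0 : ℝ)..t, k s := by simp [hP]
  rw [e1, e2, smul_eq_mul, zero_add, mul_zero, Real.exp_zero, one_mul,
    ← intervalIntegral.integral_const_mul, ← intervalIntegral.integral_sub
    ((by fun_prop : Continuous fun s => Real.exp (r * ε) * k (s + ε)).intervalIntegrable _ _)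
    (hint _ _)]
  congr 1
  refine intervalIntegral.integral_congr fun s _ => ?_
  simp only [hk]
  rw [← mul_assoc, ← Real.exp_add]
  ring_nf

theorem tendsto_forward_average {f : ℝ → ℝ} (hf : Continuous f) (t : ℝ) :
    Tendsto (fun ε : ℝ => ε⁻¹ * ∫ s in (0 : ℝ)..t, (f (s + ε) - f s)) (𝓝[>] 0)
      (𝓝 (f t - f 0)) := by
  simpa using tendsto_exp_forward_average 0 hf t

/-- Pointwise convergence of primitives of nonnegative densities implies convergence of
integrals of polynomials. -/
theorem tendsto_integral_polynomial_mul {t : ℝ} (ht : 0 ≤ t) {g : ℕ → ℝ → ℝ} {g₀ : ℝ → ℝ}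
    (hg : ∀ n, Continuous (g n)) (hg₀ : Continuous g₀) (hpos : ∀ n s, 0 ≤ g n s)
    (h : ∀ u ∈ Icc 0 t, Tendsto (fun n => ∫ s in (0 : ℝ)..u, g n s) atTop
      (𝓝 (∫ s in (0 : ℝ)..u, g₀ s))) (p : Polynomial ℝ) :
    Tendsto (fun n => ∫ s in (0 : ℝ)..t, p.eval s * g n s) atTop
      (𝓝 (∫ s in (0 : ℝ)..t, p.eval s * g₀ s)) := by
  -- Integration by parts moves the limit onto the primitives. As the densities are nonnegative, all
  -- primitives are eventually dominated by the bound B on the total mass.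
  have ibp : ∀ f : ℝ → ℝ, Continuous f → ∫ s in (0 : ℝ)..t, p.eval s * f s =
      p.eval t * (∫ s in (0 : ℝ)..t, f s)
        - ∫ s in (0 : ℝ)..t, p.derivative.eval s * (∫ x in (0 : ℝ)..s, f x) := by
    intro f hf
    have := intervalIntegral.integral_mul_deriv_eq_deriv_mul (a := 0) (b := t)
      (u := fun s => p.eval s) (v := fun s => ∫ x in (0 : ℝ)..s, f x)
      (u' := fun s => p.derivative.eval s) (v' := f) (fun x _ => p.hasDerivAt x)
      (fun x _ => (hf.integral_hasStrictDerivAt 0 x).hasDerivAt)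
      (p.derivative.continuous.intervalIntegrable _ _) (hf.intervalIntegrable _ _)
    simpa using this
  simp_rw [ibp _ (hg _), ibp _ hg₀]
  refine ((h t ⟨ht, le_rfl⟩).const_mul _).sub ?_
  set B := (∫ s in (0 : ℝ)..t, g₀ s) + 1
  have hB : ∀ᶠ n in atTop, ∫ s in (0 : ℝ)..t, g n s < B :=
    (h t ⟨ht, le_rfl⟩).eventually_lt_const (by simp [B])
  refine intervalIntegral.tendsto_integral_filter_of_dominated_convergence
    (fun s => |p.derivative.eval s| * B) (Eventually.of_forall fun n => ?_) ?_
    ((p.derivative.continuous.abs.mul_const B).intervalIntegrable _ _)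
    (Eventually.of_forall fun s hs => ?_)
  · exact (p.derivative.continuous.mul
      (intervalIntegral.continuous_primitive (fun a b => (hg n).intervalIntegrable a b) 0)).aestronglyMeasurable
  · filter_upwards [hB] with n hn
    refine Eventually.of_forall fun s hs => ?_
    rw [uIoc_of_le ht] at hs
    rw [norm_mul, Real.norm_eq_abs, Real.norm_eq_abs]
    gcongr
    rw [abs_of_nonneg (intervalIntegral.integral_nonneg hs.1.le fun x _ => hpos n x)]
    refine le_trans ?_ hn.le
    exact intervalIntegral.integral_mono_interval le_rfl hs.1.le hs.2
      (Eventually.of_forall fun x => hpos n x) ((hg n).intervalIntegrable _ _)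
  · rw [uIoc_of_le ht] at hs
    exact (h s ⟨hs.1.le, hs.2⟩).const_mul _

/-- Pointwise convergence of primitives of nonnegative densities implies weak convergence. -/
theorem tendsto_integral_mul_of_tendsto_primitive {t : ℝ} (ht : 0 ≤ t) {g : ℕ → ℝ → ℝ}
    {g₀ f : ℝ → ℝ} (hg : ∀ n, Continuous (g n)) (hg₀ : Continuous g₀) (hpos : ∀ n s, 0 ≤ g n s)
    (hpos₀ : ∀ s, 0 ≤ g₀ s)
    (h : ∀ u ∈ Icc 0 t, Tendsto (fun n => ∫ s in (0 : ℝ)..u, g n s) atTop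
      (𝓝 (∫ s in (0 : ℝ)..u, g₀ s))) (hf : ContinuousOn f (Icc 0 t)) :
    Tendsto (fun n => ∫ s in (0 : ℝ)..t, f s * g n s) atTop
      (𝓝 (∫ s in (0 : ℝ)..t, f s * g₀ s)) := by
  have hfi : ∀ k : ℝ → ℝ, Continuous k → IntervalIntegrable (fun s => f s * k s) volume 0 t :=
    fun k hk => ((hf.mul hk.continuousOn).mono (by rw [uIcc_of_le ht])).intervalIntegrable
  set B := (∫ s in (0 : ℝ)..t, g₀ s) + 1
  have hg₀0 : 0 ≤ ∫ s in (0 : ℝ)..t, g₀ s := intervalIntegral.integral_nonneg ht fun s _ => hpos₀ s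
  have hB0 : 0 < B := by simp only [B]; linarith
  have hB : ∀ᶠ n in atTop, ∫ s in (0 : ℝ)..t, g n s < B :=
    (h t ⟨ht, le_rfl⟩).eventually_lt_const (by simp [B])
  rw [Metric.tendsto_atTop']
  intro η hη
  -- Weierstrass approximation reduces to polynomials; with total mass at most B, this tolerance
  -- costs η/3 on each side.
  obtain ⟨p, hp⟩ := exists_polynomial_near_of_continuousOn 0 t f hf (η / (3 * B)) (by positivity)
  have hclose : ∀ k : ℝ → ℝ, Continuous k → (∀ s, 0 ≤ k s) → ∫ s in (0 : ℝ)..t, k s ≤ B →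
      |(∫ s in (0 : ℝ)..t, f s * k s) - ∫ s in (0 : ℝ)..t, p.eval s * k s| ≤ η / 3 := by
    intro k hk hk0 hkB
    rw [← intervalIntegral.integral_sub (hfi k hk)
      ((p.continuous.fun_mul hk).intervalIntegrable _ _)]
    calc |∫ s in (0 : ℝ)..t, (f s * k s - p.eval s * k s)|
        ≤ ∫ s in (0 : ℝ)..t, η / (3 * B) * k s := by
          rw [← Real.norm_eq_abs]
          refine intervalIntegral.norm_integral_le_of_norm_le ht
            (Eventually.of_forall fun s hs => ?_) ((hk.const_mul _).intervalIntegrable _ _)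
          rw [← sub_mul, norm_mul, Real.norm_eq_abs, Real.norm_eq_abs, abs_of_nonneg (hk0 s),
            abs_sub_comm]
          gcongr
          · exact hk0 s
          · exact (hp s ⟨hs.1.le, hs.2⟩).le
      _ = η / (3 * B) * ∫ s in (0 : ℝ)..t, k s := intervalIntegral.integral_const_mul _ _
      _ ≤ η / (3 * B) * B := by gcongr
      _ = η / 3 := by field_simp
  have hpoly := tendsto_integral_polynomial_mul ht hg hg₀ hpos h p
  have hev : ∀ᶠ n in atTop, dist (∫ s in (0 : ℝ)..t, f s * g n s)
      (∫ s in (0 : ℝ)..t, f s * g₀ s) < η := by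
    filter_upwards [hB, Metric.tendsto_nhds.1 hpoly (η / 3) (by positivity)] with n hn hpn
    have h1 := hclose (g n) (hg n) (hpos n) hn.le
    have h2 := hclose g₀ hg₀ hpos₀ (by simp [B])
    rw [Real.dist_eq] at hpn ⊢
    rw [abs_le] at h1 h2
    rw [abs_lt] at hpn ⊢
    constructor <;> linarith
  obtain ⟨N, hN⟩ := eventually_atTop.1 hev
  exact ⟨N, fun n hn => hN n hn.le⟩

/-! ### Pathwise Itô formula for the hedge. -/

theorem ContDiff.exists_taylor_two {f : ℝ → ℝ} (hf : ContDiff ℝ 2 f) (x y : ℝ) :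
    ∃ ξ ∈ uIcc x y, f y = f x + deriv f x * (y - x) + 1 / 2 * iteratedDeriv 2 f ξ * (y - x) ^ 2 := by
  rcases eq_or_ne x y with rfl | hxy
  · exact ⟨x, by simp, by simp⟩
  obtain ⟨ξ, hξ, h⟩ := taylor_mean_remainder_lagrange_iteratedDeriv (n := 1) hxy
    (by exact_mod_cast hf.contDiffOn)
  refine ⟨ξ, uIoo_subset_uIcc_self hξ, ?_⟩
  rw [taylorWithinEval_succ, taylor_within_zero_eval, iteratedDerivWithin_one,
    ((hf.differentiable (by norm_num) x).derivWithin (uniqueDiffOn_uIcc hxy x left_mem_uIcc))] at h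
  norm_num at h
  linarith

theorem IsC12.exists_timeDeriv_eq {v : ℝ → ℝ → ℝ} (hv : IsC12 v) {s t : ℝ} (hs : 0 ≤ s)
    (hst : s < t) (ht : t < 1) (y : ℝ) :
    ∃ ξ ∈ Icc s t, v t y - v s y = (t - s) * timeDeriv v ξ y := by
  have hsub : Icc s t ⊆ Ico 0 1 := fun x hx => ⟨hs.trans hx.1, hx.2.trans_lt ht⟩
  obtain ⟨ξ, hξ, h⟩ := exists_hasDerivAt_eq_slope (fun u => v u y) (fun u => timeDeriv v u y) hst
    (fun x hx => (hv.time_diff x (hsub hx) y).continuousWithinAt.mono hsub)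
    (fun x hx => (hv.time_diff x (hsub (Ioo_subset_Icc_self hx)) y).hasDerivWithinAt.hasDerivAt
      (Ico_mem_nhds (hs.trans_lt hx.1) (hx.2.trans ht)))
  refine ⟨ξ, Ioo_subset_Icc_self hξ, ?_⟩
  rw [h]
  field_simp [(sub_pos.2 hst).ne']

/-- A continuous function vanishing on the diagonal is uniformly small near it. -/
theorem exists_forall_abs_lt_of_diagonal {T : ℝ} {E : ℝ → ℝ → ℝ → ℝ → ℝ}
    (hE : ContinuousOn (fun p : ℝ × ℝ × ℝ × ℝ => E p.1 p.2.1 p.2.2.1 p.2.2.2)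
      (Icc 0 T ×ˢ Icc 0 T ×ˢ Icc 0 T ×ˢ Icc 0 T))
    (hdiag : ∀ s ∈ Icc 0 T, E s s s s = 0) {η : ℝ} (hη : 0 < η) :
    ∃ δ > 0, ∀ ε ∈ Ioo 0 δ, ∀ s a b c, 0 ≤ s → s + ε ≤ T → a ∈ Icc s (s + ε) →
      b ∈ Icc s (s + ε) → c ∈ Icc s (s + ε) → |E s a b c| < η := by
  have hK : IsCompact (Icc 0 T ×ˢ Icc 0 T ×ˢ Icc 0 T ×ˢ Icc (0 : ℝ) T) :=
    isCompact_Icc.prod (isCompact_Icc.prod (isCompact_Icc.prod isCompact_Icc))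
  obtain ⟨δ, hδ, h⟩ := Metric.uniformContinuousOn_iff.1 (hK.uniformContinuousOn_of_continuous hE) η hη
  refine ⟨δ, hδ, fun ε hε s a b c hs hsT ha hb hc => ?_⟩
  have hm : ∀ x ∈ Icc s (s + ε), x ∈ Icc 0 T := fun x hx => ⟨hs.trans hx.1, hx.2.trans hsT⟩
  have hsm : s ∈ Icc s (s + ε) := ⟨le_rfl, by linarith [hε.1]⟩
  have hd : ∀ x ∈ Icc s (s + ε), dist x s < δ := fun x hx => by
    rw [Real.dist_eq, abs_of_nonneg (by linarith [hx.1])]; linarith [hx.2, hε.2]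
  have := h (s, a, b, c) ⟨hm s hsm, hm a ha, hm b hb, hm c hc⟩
    (s, s, s, s) ⟨hm s hsm, hm s hsm, hm s hsm, hm s hsm⟩
    (by
      simp only [Prod.dist_eq]
      exact max_lt (hd s hsm) (max_lt (hd a ha) (max_lt (hd b hb) (hd c hc))))
  simpa [Real.dist_eq, hdiag s (hm s hsm)] using this

/-- The path of `Z`. -/
noncomputable def pathZ (S : ℝ → ℝ) (K t : ℝ) : ℝ := (∫ s in (0 : ℝ)..t, S s) - K

/-- The path of `Z / S`. -/
noncomputable def pathY (S : ℝ → ℝ) (K t : ℝ) : ℝ := pathZ S K t / S t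

/-- The path `v(t, Z_t / S_t) S_t`. -/
noncomputable def wealthPath (v : ℝ → ℝ → ℝ) (S : ℝ → ℝ) (K t : ℝ) : ℝ := v t (pathY S K t) * S t

/-- The path `v(t, Z_t / S_t) - ∂_y v(t, Z_t / S_t) Z_t / S_t`. -/
noncomputable def hedgePath (v : ℝ → ℝ → ℝ) (S : ℝ → ℝ) (K t : ℝ) : ℝ :=
  v t (pathY S K t) - deriv (v t) (pathY S K t) * pathY S K t

/-- The path of the forward integral of the hedge. -/
noncomputable def gainPath (v : ℝ → ℝ → ℝ) (r : ℝ) (S : ℝ → ℝ) (K t : ℝ) : ℝ :=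
  wealthPath v S K t - wealthPath v S K 0
    - r * ∫ s in (0 : ℝ)..t, pathZ S K s * deriv (v s) (pathY S K s)

section Path

variable {v : ℝ → ℝ → ℝ} {S : ℝ → ℝ} {K : ℝ}

theorem hasDerivAt_pathZ (hS : Continuous S) (t : ℝ) : HasDerivAt (pathZ S K) (S t) t :=
  ((hS.integral_hasStrictDerivAt 0 t).hasDerivAt).sub_const K

theorem continuous_pathZ (hS : Continuous S) : Continuous (pathZ S K) :=
  continuous_iff_continuousAt.2 fun t => (hasDerivAt_pathZ hS t).continuousAt

theorem continuous_pathY (hS : Continuous S) (hpos : ∀ t, 0 < S t) : Continuous (pathY S K) :=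
  (continuous_pathZ hS).div hS fun t => (hpos t).ne'

theorem continuousOn_along {g : ℝ → ℝ → ℝ} {s : Set ℝ}
    (hg : ContinuousOn (fun p : ℝ × ℝ => g p.1 p.2) (s ×ˢ univ)) {Y : ℝ → ℝ} (hY : Continuous Y) :
    ContinuousOn (fun t => g t (Y t)) s :=
  hg.comp (f := fun t => (t, Y t)) (by fun_prop) fun t ht => ⟨ht, mem_univ _⟩

theorem continuousOn_wealthPath (hS : Continuous S) (hpos : ∀ t, 0 < S t)
    (hcont : ContinuousOn (fun p : ℝ × ℝ => v p.1 p.2) (Icc 0 1 ×ˢ univ)) :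
    ContinuousOn (wealthPath v S K) (Icc 0 1) :=
  (continuousOn_along hcont (continuous_pathY hS hpos)).mul hS.continuousOn

theorem continuousOn_hedgePath (hS : Continuous S) (hpos : ∀ t, 0 < S t) (hv : IsC12 v)
    (hcont : ContinuousOn (fun p : ℝ × ℝ => v p.1 p.2) (Icc 0 1 ×ˢ univ)) :
    ContinuousOn (hedgePath v S K) (Ico 0 1) :=
  ((continuousOn_along hcont (continuous_pathY hS hpos)).mono Ico_subset_Icc_self).sub
    ((continuousOn_along hv.space_cont (continuous_pathY hS hpos)).mul
      (continuous_pathY hS hpos).continuousOn)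

/-- Second order expansion of the wealth path, with explicit remainder. -/
theorem wealthPath_increment (hS : Continuous S) (hpos : ∀ t, 0 < S t) (hv : IsC12 v)
    {s ε : ℝ} (hs : 0 ≤ s) (hε : 0 < ε) (hsε : s + ε < 1) :
    ∃ a ∈ Icc s (s + ε), ∃ b ∈ Icc s (s + ε), ∃ c ∈ Icc s (s + ε),
      wealthPath v S K (s + ε) - wealthPath v S K s =
        hedgePath v S K s * (S (s + ε) - S s)
        + ε * (S (s + ε) * timeDeriv v a (pathY S K (s + ε)))
        + ε * (deriv (v s) (pathY S K s) * S b)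
        + 1 / 2 * iteratedDeriv 2 (v s) (pathY S K c) / S (s + ε)
          * (ε * S b - (S (s + ε) - S s) * pathY S K s) ^ 2 := by
  obtain ⟨a, ha, h1⟩ := hv.exists_timeDeriv_eq hs (show s < s + ε by linarith) hsε
    (pathY S K (s + ε))
  obtain ⟨b, hb, h2⟩ := exists_hasDerivAt_eq_slope (pathZ S K) S (show s < s + ε by linarith)
    (continuous_pathZ hS).continuousOn (fun x _ => hasDerivAt_pathZ hS x)
  obtain ⟨ξ, hξ, h3⟩ := (hv.space_diff s ⟨hs, by linarith⟩).exists_taylor_two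
    (pathY S K s) (pathY S K (s + ε))
  -- The intermediate point of Taylor's formula is a value of the continuous path Y, so it can be
  -- replaced by a time in [s, s + ε].
  obtain ⟨c, hc, rfl⟩ := intermediate_value_uIcc
    (continuous_pathY (K := K) hS hpos).continuousOn hξ
  rw [uIcc_of_le (by linarith)] at hc
  refine ⟨a, ha, b, Ioo_subset_Icc_self hb, c, hc, ?_⟩
  have hne := (hpos (s + ε)).ne'
  have hne' := (hpos s).ne'
  have hZ : pathZ S K (s + ε) - pathZ S K s = ε * S b := by
    rw [h2, add_sub_cancel_left]; field_simp
  have hY : pathY S K (s + ε) * S (s + ε) = pathZ S K (s + ε) := by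
    rw [pathY]; field_simp
  have hY' : pathY S K s * S s = pathZ S K s := by rw [pathY]; field_simp
  have hdY : S (s + ε) * (pathY S K (s + ε) - pathY S K s)
      = ε * S b - (S (s + ε) - S s) * pathY S K s := by
    linear_combination hY - hY' + hZ
  rw [← hdY]
  have e : 1 / 2 * iteratedDeriv 2 (v s) (pathY S K c) / S (s + ε)
      * (S (s + ε) * (pathY S K (s + ε) - pathY S K s)) ^ 2
      = S (s + ε) * (1 / 2 * iteratedDeriv 2 (v s) (pathY S K c)
        * (pathY S K (s + ε) - pathY S K s) ^ 2) := by
    field_simp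
  rw [e]
  simp only [wealthPath, hedgePath]
  linear_combination S (s + ε) * h1 + S (s + ε) * h3 + deriv (v s) (pathY S K s) * hdY

/-- Uniform smallness of the remainder in the second order expansion. -/
theorem hedgePath_remainder (hS : Continuous S) (hpos : ∀ t, 0 < S t) (hv : IsC12 v)
    {T : ℝ} (hT : T < 1) {η : ℝ} (hη : 0 < η) :
    ∃ δ > 0, ∀ ε ∈ Ioo 0 δ, ∀ s ∈ Icc 0 T,
      |hedgePath v S K s * (S (s + ε) - S s) - ((wealthPath v S K (s + ε) - wealthPath v S K s)
        - ε * (S s * timeDeriv v s (pathY S K s) + deriv (v s) (pathY S K s) * S s)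
        - 1 / 2 * iteratedDeriv 2 (v s) (pathY S K s) / S s * pathY S K s ^ 2
          * (S (s + ε) - S s) ^ 2)| ≤ η * (ε + (S (s + ε) - S s) ^ 2) := by
  -- A horizon strictly between T and 1 leaves room for s + ε while staying where the derivatives of
  -- v are continuous.
  set T₁ := (1 + T) / 2
  have hT1 : T₁ < 1 := by simp only [T₁]; linarith
  have hTT : T < T₁ := by simp only [T₁]; linarith
  have hY := continuous_pathY (K := K) hS hpos
  have hsub : Icc 0 T₁ ⊆ Ico 0 1 := fun x hx => ⟨hx.1, hx.2.trans_lt hT1⟩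
  have hc : ∀ {g : ℝ → ℝ → ℝ},
      ContinuousOn (fun p : ℝ × ℝ => g p.1 p.2) (Ico 0 1 ×ˢ univ) →
      ∀ {i j : ℝ × ℝ × ℝ × ℝ → ℝ}, Continuous i → Continuous j →
      (∀ p ∈ Icc 0 T₁ ×ˢ Icc 0 T₁ ×ˢ Icc 0 T₁ ×ˢ Icc 0 T₁, i p ∈ Icc 0 T₁) →
      ContinuousOn (fun p => g (i p) (pathY S K (j p)))
        (Icc 0 T₁ ×ˢ Icc 0 T₁ ×ˢ Icc 0 T₁ ×ˢ Icc 0 T₁) := by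
    intro g hg i j hi hj hij
    exact hg.comp (f := fun p => (i p, pathY S K (j p)))
      (hi.prodMk (hY.comp hj)).continuousOn fun p hp => ⟨hsub (hij p hp), mem_univ _⟩
  have hdiv : ∀ {i : ℝ × ℝ × ℝ × ℝ → ℝ}, Continuous i → Continuous fun p => (S (i p))⁻¹ :=
    fun hi => (hS.comp hi).inv₀ fun p => (hpos _).ne'
  -- Three errors vanish on the diagonal: the shifted first order terms; the part of (ε S_b − Y ΔS)²
  -- that carries a factor ε; and the shifted coefficient of (ΔS)².
  obtain ⟨δ₁, hδ₁, h₁⟩ := exists_forall_abs_lt_of_diagonal (T := T₁) (η := η / 2)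
    (E := fun s x a b => S x * timeDeriv v a (pathY S K x) - S s * timeDeriv v s (pathY S K s)
      + deriv (v s) (pathY S K s) * (S b - S s))
    (by
      refine ContinuousOn.add (ContinuousOn.sub (ContinuousOn.mul ?_ ?_) (ContinuousOn.mul ?_ ?_))
        (ContinuousOn.mul ?_ ?_)
      · fun_prop
      · exact hc hv.time_cont (by fun_prop) (by fun_prop) fun p hp => hp.2.2.1
      · fun_prop
      · exact hc hv.time_cont (by fun_prop) (by fun_prop) fun p hp => hp.1
      · exact hc (g := fun t y => deriv (v t) y) hv.space_cont (by fun_prop) (by fun_prop) fun p hp => hp.1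
      · fun_prop)
    (by simp) (by positivity)
  obtain ⟨δ₂, hδ₂, h₂⟩ := exists_forall_abs_lt_of_diagonal (T := T₁) (η := η / 2)
    (E := fun s x b c => 1 / 2 * (iteratedDeriv 2 (v s) (pathY S K c) * (S x)⁻¹)
      * ((x - s) * S b ^ 2 - 2 * S b * (S x - S s) * pathY S K s))
    (by
      refine ContinuousOn.mul (ContinuousOn.mul continuousOn_const (ContinuousOn.mul ?_ ?_)) ?_
      · exact hc (g := fun t y => iteratedDeriv 2 (v t) y) hv.space_cont₂ (by fun_prop)
          (by fun_prop) fun p hp => hp.1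
      · exact (hdiv (by fun_prop)).continuousOn
      · fun_prop)
    (by simp) (by positivity)
  obtain ⟨δ₃, hδ₃, h₃⟩ := exists_forall_abs_lt_of_diagonal (T := T₁) (η := η)
    (E := fun s x b c => 1 / 2 * (iteratedDeriv 2 (v s) (pathY S K c) * (S x)⁻¹
      - iteratedDeriv 2 (v s) (pathY S K s) * (S s)⁻¹) * pathY S K s ^ 2)
    (by
      refine ContinuousOn.mul (ContinuousOn.mul continuousOn_const (ContinuousOn.sub
        (ContinuousOn.mul ?_ ?_) (ContinuousOn.mul ?_ ?_))) ?_
      · exact hc (g := fun t y => iteratedDeriv 2 (v t) y) hv.space_cont₂ (by fun_prop)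
          (by fun_prop) fun p hp => hp.1
      · exact (hdiv (by fun_prop)).continuousOn
      · exact hc (g := fun t y => iteratedDeriv 2 (v t) y) hv.space_cont₂ (by fun_prop)
          (by fun_prop) fun p hp => hp.1
      · exact (hdiv (by fun_prop)).continuousOn
      · fun_prop)
    (by simp) hη
  refine ⟨min (min δ₁ δ₂) (min δ₃ (T₁ - T)), lt_min (lt_min hδ₁ hδ₂) (lt_min hδ₃ (by linarith)),
    fun ε hε s hs => ?_⟩
  obtain ⟨⟨hε1, hε2⟩, hε3, hε4⟩ : (ε < δ₁ ∧ ε < δ₂) ∧ ε < δ₃ ∧ ε < T₁ - T := by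
    have := hε.2
    simpa only [lt_min_iff] using this
  have hε0 : 0 < ε := hε.1
  have hsT : s + ε ≤ T₁ := by linarith [hs.2]
  obtain ⟨a, ha, b, hb, c, hc', hinc⟩ := wealthPath_increment (K := K) hS hpos hv hs.1 hε0
    (hsT.trans_lt hT1)
  have hx : s + ε ∈ Icc s (s + ε) := ⟨by linarith, le_rfl⟩
  have k₁ := h₁ ε ⟨hε0, hε1⟩ s _ a b hs.1 hsT hx ha hb
  have k₂ := h₂ ε ⟨hε0, hε2⟩ s _ b c hs.1 hsT hx hb hc'
  have k₃ := h₃ ε ⟨hε0, hε3⟩ s _ b c hs.1 hsT hx hb hc'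
  set e₁ := S (s + ε) * timeDeriv v a (pathY S K (s + ε)) - S s * timeDeriv v s (pathY S K s)
      + deriv (v s) (pathY S K s) * (S b - S s) with he₁
  set e₂ := 1 / 2 * (iteratedDeriv 2 (v s) (pathY S K c) * (S (s + ε))⁻¹)
      * ((s + ε - s) * S b ^ 2 - 2 * S b * (S (s + ε) - S s) * pathY S K s) with he₂
  set e₃ := 1 / 2 * (iteratedDeriv 2 (v s) (pathY S K c) * (S (s + ε))⁻¹
      - iteratedDeriv 2 (v s) (pathY S K s) * (S s)⁻¹) * pathY S K s ^ 2 with he₃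
  rw [hinc]
  calc _ = |-(ε * e₁ + ε * e₂ + (S (s + ε) - S s) ^ 2 * e₃)| := by
        rw [he₁, he₂, he₃]
        congr 1
        ring
    _ ≤ ε * |e₁| + ε * |e₂| + (S (s + ε) - S s) ^ 2 * |e₃| := by
        rw [abs_neg]
        refine (abs_add_three _ _ _).trans (le_of_eq ?_)
        rw [abs_mul ε e₁, abs_mul ε e₂, abs_mul _ e₃, abs_of_pos hε0,
          abs_of_nonneg (sq_nonneg (S (s + ε) - S s))]
    _ ≤ ε * (η / 2) + ε * (η / 2) + (S (s + ε) - S s) ^ 2 * η := by gcongr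
    _ = _ := by ring

/-- Pathwise Itô formula for the hedge along a sequence for which the quadratic variation
converges. -/
theorem tendsto_forward_hedgePath (hS : Continuous S) (hpos : ∀ t, 0 < S t) (hv : IsC12 v)
    (hcont : ContinuousOn (fun p : ℝ × ℝ => v p.1 p.2) (Icc 0 1 ×ˢ univ)) {σ r : ℝ}
    (hpde : ∀ t ∈ Ico (0 : ℝ) 1, ∀ y : ℝ,
      1 / 2 * σ ^ 2 * y ^ 2 * iteratedDeriv 2 (v t) y + (1 - r * y) * deriv (v t) y
        + timeDeriv v t y = 0)
    {ε : ℕ → ℝ} (hε : Tendsto ε atTop (𝓝[>] 0))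
    (hqv : ∀ t ∈ Icc (0 : ℝ) 1, Tendsto (fun n => (ε n)⁻¹ * ∫ s in (0 : ℝ)..t,
      (S (min (s + ε n) 1) - S s) * (S (min (s + ε n) 1) - S s)) atTop
      (𝓝 (∫ s in (0 : ℝ)..t, σ ^ 2 * S s ^ 2)))
    {t : ℝ} (ht : t ∈ Ico (0 : ℝ) 1) :
    Tendsto (fun n => (ε n)⁻¹ * ∫ s in (0 : ℝ)..t,
      hedgePath v S K s * (S (min (s + ε n) 1) - S s)) atTop (𝓝 (gainPath v r S K t)) := by
  have hY := continuous_pathY (K := K) hS hpos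
  have hIcc : Icc 0 t ⊆ Ico 0 1 := fun x hx => ⟨hx.1, hx.2.trans_lt ht.2⟩
  have hpos_ev : ∀ᶠ n in atTop, ε n ∈ Ioi (0 : ℝ) := hε.eventually self_mem_nhdsWithin
  have hsmall : ∀ {δ : ℝ}, 0 < δ → ∀ᶠ n in atTop, ε n ∈ Ioo 0 δ := fun hδ =>
    hε.eventually (Ioo_mem_nhdsGT hδ)
  set B : ℝ → ℝ := fun s => S s * timeDeriv v s (pathY S K s) + deriv (v s) (pathY S K s) * S s
    with hBdef
  set A : ℝ → ℝ := fun s => 1 / 2 * iteratedDeriv 2 (v s) (pathY S K s) / S s * pathY S K s ^ 2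
    with hAdef
  set H := hedgePath v S K with hHdef
  set F := wealthPath v S K with hFdef
  have hHc : ContinuousOn H (Icc 0 t) := (continuousOn_hedgePath hS hpos hv hcont).mono hIcc
  have hvyc : ContinuousOn (fun s => deriv (v s) (pathY S K s)) (Icc 0 t) :=
    (continuousOn_along (g := fun t y => deriv (v t) y) hv.space_cont hY).mono hIcc
  have hBc : ContinuousOn B (Icc 0 t) :=
    (hS.continuousOn.mul ((continuousOn_along hv.time_cont hY).mono hIcc)).add
      (hvyc.mul hS.continuousOn)
  have hAc : ContinuousOn A (Icc 0 t) :=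
    ((continuousOn_const.mul ((continuousOn_along (g := fun t y => iteratedDeriv 2 (v t) y)
      hv.space_cont₂ hY).mono hIcc)).div hS.continuousOn fun x _ => (hpos x).ne').mul
      (hY.pow 2).continuousOn
  -- Clamping time gives a continuous function on the whole line, equal to F at all times used once
  -- ε < 1 − t.
  set Ft : ℝ → ℝ := fun s => F (max 0 (min s 1)) with hFt
  have hFtc : Continuous Ft := (continuousOn_wealthPath hS hpos hcont).comp_continuous
    (by fun_prop) fun x => ⟨le_max_left _ _, max_le zero_le_one (min_le_right _ _)⟩
  have hFteq : ∀ s ∈ Icc (0 : ℝ) 1, Ft s = F s := fun s hs => by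
    simp only [hFt]; rw [min_eq_left hs.2, max_eq_right hs.1]
  -- The absolute value makes the density nonnegative for every n; ε n is positive only eventually.
  set g : ℕ → ℝ → ℝ := fun n s => |(ε n)⁻¹| *
    ((S (min (s + ε n) 1) - S s) * (S (min (s + ε n) 1) - S s)) with hgdef
  have hgc : ∀ n, Continuous (g n) := fun n => by fun_prop
  have hg0 : ∀ n s, 0 ≤ g n s := fun n s => mul_nonneg (abs_nonneg _) (mul_self_nonneg _)
  have hqv' : ∀ u ∈ Icc 0 t, Tendsto (fun n => ∫ s in (0 : ℝ)..u, g n s) atTop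
      (𝓝 (∫ s in (0 : ℝ)..u, σ ^ 2 * S s ^ 2)) := fun u hu => by
    refine (hqv u ⟨hu.1, hu.2.trans ht.2.le⟩).congr' ?_
    filter_upwards [hpos_ev] with n hn
    rw [← intervalIntegral.integral_const_mul]
    simp only [hgdef, abs_of_pos (inv_pos.2 (mem_Ioi.1 hn))]
  have hweak := tendsto_integral_mul_of_tendsto_primitive ht.1 hgc
    (g₀ := fun s => σ ^ 2 * S s ^ 2) (by fun_prop) hg0 (fun s => by positivity) hqv' hAc
  have htot := hqv' t ⟨ht.1, le_rfl⟩
  have hint : ∀ {k : ℝ → ℝ}, ContinuousOn k (Icc 0 t) → IntervalIntegrable k volume 0 t :=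
    fun hk => (hk.mono (by rw [uIcc_of_le ht.1])).intervalIntegrable
  -- the limit of the main part
  have hmain : Tendsto (fun n => (ε n)⁻¹ * (∫ s in (0 : ℝ)..t, (Ft (s + ε n) - Ft s))
      - (∫ s in (0 : ℝ)..t, B s) - ∫ s in (0 : ℝ)..t, A s * g n s) atTop
      (𝓝 (gainPath v r S K t)) := by
    have h1 : Tendsto (fun n => (ε n)⁻¹ * (∫ s in (0 : ℝ)..t, (Ft (s + ε n) - Ft s))
        - ∫ s in (0 : ℝ)..t, B s) atTop (𝓝 (Ft t - Ft 0 - ∫ s in (0 : ℝ)..t, B s)) :=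
      ((tendsto_forward_average hFtc t).comp hε).sub_const (∫ s in (0 : ℝ)..t, B s)
    have hlim := h1.sub hweak
    suffices he : Ft t - Ft 0 - (∫ s in (0 : ℝ)..t, B s) - ∫ s in (0 : ℝ)..t,
        A s * (σ ^ 2 * S s ^ 2) = gainPath v r S K t by rwa [he] at hlim
    rw [hFteq t ⟨ht.1, ht.2.le⟩, hFteq 0 ⟨le_rfl, zero_le_one⟩, gainPath, sub_sub (F t - F 0),
      ← intervalIntegral.integral_add (hint hBc)
        (hint (hAc.fun_mul (by fun_prop : Continuous fun s => σ ^ 2 * S s ^ 2).continuousOn)),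
      ← intervalIntegral.integral_const_mul]
    congr 1
    refine intervalIntegral.integral_congr fun s hs => ?_
    rw [uIcc_of_le ht.1] at hs
    -- Here the equation turns S ∂_t v + S ∂_y v + ½ σ² S Y² ∂_yy v into r Z ∂_y v.
    have := hpde s (hIcc hs) (pathY S K s)
    have hZ : pathZ S K s = pathY S K s * S s := by
      rw [pathY, div_mul_cancel₀ _ (hpos s).ne']
    have hne := (hpos s).ne'
    simp only [hBdef, hAdef]
    rw [hZ]
    field_simp
    linear_combination 2 * this
  refine tendsto_of_tendsto_of_dist hmain ?_
  rw [Metric.tendsto_atTop']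
  intro η hη
  set Q := (∫ s in (0 : ℝ)..t, σ ^ 2 * S s ^ 2) + 1
  have hQ0 : 0 < Q := by
    have : 0 ≤ ∫ s in (0 : ℝ)..t, σ ^ 2 * S s ^ 2 :=
      intervalIntegral.integral_nonneg ht.1 fun s _ => by positivity
    simp only [Q]; linarith
  set η' := η / (2 * (t + Q)) with hη'
  have htQ : 0 < t + Q := by linarith [ht.1]
  obtain ⟨δ, hδ, hrem⟩ := hedgePath_remainder (K := K) hS hpos hv ht.2 (show 0 < η' by positivity)
  have hev : ∀ᶠ n in atTop, dist (dist ((ε n)⁻¹ * (∫ s in (0 : ℝ)..t, (Ft (s + ε n) - Ft s))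
      - (∫ s in (0 : ℝ)..t, B s) - ∫ s in (0 : ℝ)..t, A s * g n s)
      ((ε n)⁻¹ * ∫ s in (0 : ℝ)..t, H s * (S (min (s + ε n) 1) - S s))) 0 < η := by
    filter_upwards [hsmall hδ, hsmall (show 0 < 1 - t by linarith [ht.2]),
      htot.eventually_lt_const (show _ < Q by simp [Q])] with n hn1 hn2 hnQ
    have hε0 : 0 < ε n := hn1.1
    have hmin : ∀ s ∈ Icc 0 t, min (s + ε n) 1 = s + ε n := fun s hs =>
      min_eq_left (by linarith [hs.2, hn2.2])
    have hi1 : IntervalIntegrable (fun s => H s * (S (min (s + ε n) 1) - S s)) volume 0 t :=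
      hint (hHc.mul (by fun_prop : Continuous fun s => S (min (s + ε n) 1) - S s).continuousOn)
    have hi2 : IntervalIntegrable (fun s => Ft (s + ε n) - Ft s) volume 0 t :=
      (by fun_prop : Continuous fun s => Ft (s + ε n) - Ft s).intervalIntegrable _ _
    have hi3 := hint hBc
    have hi4 : IntervalIntegrable (fun s => A s * g n s) volume 0 t :=
      hint (hAc.mul (hgc n).continuousOn)
    rw [Real.dist_0_eq_abs, abs_dist, dist_comm, Real.dist_eq, ← intervalIntegral.integral_const_mul,
      ← intervalIntegral.integral_const_mul,
      ← intervalIntegral.integral_sub (hi2.const_mul _) hi3,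
      ← intervalIntegral.integral_sub ((hi2.const_mul _).sub hi3) hi4,
      ← intervalIntegral.integral_sub (hi1.const_mul _) (((hi2.const_mul _).sub hi3).sub hi4),
      ← Real.norm_eq_abs]
    refine (intervalIntegral.norm_integral_le_of_norm_le ht.1 (g := fun s => η' * (1 + g n s))
      (Eventually.of_forall fun s hs => ?_)
      ((by fun_prop : Continuous fun s => η' * (1 + g n s)).intervalIntegrable _ _)).trans_lt ?_
    · have hs' : s ∈ Icc 0 t := ⟨hs.1.le, hs.2⟩
      have h1 := hrem (ε n) hn1 s hs'
      have e1 : Ft (s + ε n) = F (s + ε n) :=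
        hFteq _ ⟨by linarith [hs.1], by linarith [hs.2, hn2.2]⟩
      have e2 : Ft s = F s := hFteq _ ⟨hs.1.le, by linarith [hs.2, ht.2]⟩
      rw [e1, e2]
      simp only [hgdef, hmin s hs', abs_of_pos (inv_pos.2 hε0)]
      rw [Real.norm_eq_abs]
      set ρ := hedgePath v S K s * (S (s + ε n) - S s) - (wealthPath v S K (s + ε n)
        - wealthPath v S K s
        - ε n * (S s * timeDeriv v s (pathY S K s) + deriv (v s) (pathY S K s) * S s)
        - 1 / 2 * iteratedDeriv 2 (v s) (pathY S K s) / S s * pathY S K s ^ 2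
        * (S (s + ε n) - S s) ^ 2) with hρ
      have e3 : (ε n)⁻¹ * (H s * (S (s + ε n) - S s)) - ((ε n)⁻¹ * (F (s + ε n) - F s) - B s
          - A s * ((ε n)⁻¹ * ((S (s + ε n) - S s) * (S (s + ε n) - S s)))) = (ε n)⁻¹ * ρ := by
        have hcancel : (ε n)⁻¹ * ε n = 1 := inv_mul_cancel₀ hε0.ne'
        simp only [hρ, hBdef, hAdef, hHdef, hFdef]
        linear_combination (-(S s * timeDeriv v s (pathY S K s)
          + deriv (v s) (pathY S K s) * S s)) * hcancel
      rw [e3, abs_mul, abs_of_pos (inv_pos.2 hε0)]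
      calc (ε n)⁻¹ * |ρ| ≤ (ε n)⁻¹ * (η' * (ε n + (S (s + ε n) - S s) ^ 2)) :=
            mul_le_mul_of_nonneg_left h1 (inv_pos.2 hε0).le
        _ = _ := by field_simp
    · rw [intervalIntegral.integral_const_mul, intervalIntegral.integral_add (by simp)
        ((hgc n).intervalIntegrable _ _)]
      simp only [intervalIntegral.integral_const, sub_zero, smul_eq_mul, mul_one]
      calc η' * (t + ∫ s in (0 : ℝ)..t, g n s) ≤ η' * (t + Q) := by gcongr
        _ = η / 2 := by rw [hη']; field_simp
        _ < η := by linarith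
  obtain ⟨N, hN⟩ := eventually_atTop.1 hev
  exact ⟨N, fun n hn => hN n hn.le⟩

/-! ### Behaviour of the gain near maturity. -/

/-- The distance of `Z / S` from zero is at least linear in the time to maturity. -/
theorem exists_le_abs_pathY (hS : Continuous S) (hpos : ∀ t, 0 < S t) :
    ∃ c > 0, ∀ᶠ t in 𝓝[<] 1, c * (1 - t) ≤ |pathY S K t| := by
  by_cases h0 : pathZ S K 1 = 0
  · obtain ⟨x, -, hx⟩ := isCompact_Icc.exists_isMinOn (nonempty_Icc.2 (zero_le_one (α := ℝ)))
      hS.continuousOn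
    obtain ⟨y, -, hy⟩ := isCompact_Icc.exists_isMaxOn (nonempty_Icc.2 (zero_le_one (α := ℝ)))
      hS.continuousOn
    refine ⟨S x / S y, div_pos (hpos x) (hpos y), ?_⟩
    filter_upwards [Ioo_mem_nhdsLT (zero_lt_one (α := ℝ))] with t ht
    obtain ⟨b, hb, h2⟩ := exists_hasDerivAt_eq_slope (pathZ S K) S ht.2
      (continuous_pathZ hS).continuousOn (fun x _ => hasDerivAt_pathZ hS x)
    have hxb : S x ≤ S b := hx ⟨ht.1.le.trans hb.1.le, hb.2.le⟩
    have hyt : S t ≤ S y := hy ⟨ht.1.le, ht.2.le⟩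
    have hτ : 0 < 1 - t := by linarith [ht.2]
    have hZ : pathZ S K t = -(S b * (1 - t)) := by
      rw [h2, h0]; field_simp; ring
    rw [pathY, hZ, abs_div, abs_neg, abs_of_pos (mul_pos (hpos b) hτ), abs_of_pos (hpos t),
      div_mul_eq_mul_div]
    exact div_le_div₀ (mul_pos (hpos b) hτ).le (by gcongr) (hpos t) hyt
  · have hY1 : 0 < |pathY S K 1| := abs_pos.2 (div_ne_zero h0 (hpos 1).ne')
    refine ⟨|pathY S K 1| / 2, by positivity, ?_⟩
    have h1 : ∀ᶠ t in 𝓝[<] (1 : ℝ), |pathY S K 1| / 2 < |pathY S K t| :=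
      ((continuous_pathY (K := K) hS hpos).abs.tendsto 1).mono_left nhdsWithin_le_nhds
        |>.eventually_const_lt (by linarith)
    filter_upwards [h1, Ioo_mem_nhdsLT (zero_lt_one (α := ℝ))] with t ht ht'
    refine le_trans ?_ ht.le
    exact mul_le_of_le_one_right (by positivity) (by linarith [ht'.1])

/-- Continuity handles times away from 1; near 1 the comparison function (1 − s)^(−1/2) is
integrable. -/
theorem intervalIntegrable_of_le_inv_sqrt {φ : ℝ → ℝ} (hφ : ContinuousOn φ (Ico 0 1)) {C : ℝ}
    (hC : ∀ᶠ s in 𝓝[<] 1, |φ s| ≤ C / √(1 - s)) : IntervalIntegrable φ volume 0 1 := by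
  obtain ⟨a, ha, hab⟩ := (mem_nhdsLT_iff_exists_Ioo_subset' (zero_lt_one (α := ℝ))).1 hC
  set a' := max a (1 / 2)
  have ha0 : 0 < a' := lt_max_of_lt_right (by norm_num)
  have ha1 : a' < 1 := max_lt ha (by norm_num)
  refine (hφ.mono (by
    rw [uIcc_of_le ha0.le]
    exact fun x hx => ⟨hx.1, hx.2.trans_lt ha1⟩)).intervalIntegrable.trans (b := a') ?_
  have hg : IntervalIntegrable (fun s : ℝ => C * (1 - s) ^ (-(1 / 2) : ℝ)) volume a' 1 := by
    have h1 : IntervalIntegrable (fun x : ℝ => x ^ (-(1 / 2) : ℝ)) volume (1 - a') (1 - 1) :=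
      intervalIntegral.intervalIntegrable_rpow' (by norm_num)
    have h2 := (h1.comp_sub_left 1).const_mul C
    rwa [sub_sub_cancel, sub_sub_cancel] at h2
  rw [intervalIntegrable_iff_integrableOn_Ioo_of_le ha1.le] at hg ⊢
  refine Integrable.mono' hg ((hφ.mono fun x hx =>
    ⟨ha0.le.trans hx.1.le, hx.2⟩).aestronglyMeasurable measurableSet_Ioo) ?_
  refine (ae_restrict_iff' measurableSet_Ioo).2 (Eventually.of_forall fun s hs => ?_)
  rw [Real.norm_eq_abs, Real.rpow_neg (by linarith [hs.2]), ← Real.sqrt_eq_rpow, ← div_eq_mul_inv]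
  exact hab ⟨(le_max_left _ _).trans_lt hs.1, hs.2⟩

theorem continuousOn_pathZ_mul_deriv (hS : Continuous S) (hpos : ∀ t, 0 < S t) (hv : IsC12 v) :
    ContinuousOn (fun s => pathZ S K s * deriv (v s) (pathY S K s)) (Ico 0 1) :=
  (continuous_pathZ hS).continuousOn.mul (continuousOn_along (g := fun t y => deriv (v t) y)
    hv.space_cont (continuous_pathY hS hpos))

/-- Writing Z ∂_y v = S · (Y ∂_y v) makes the weighted gradient bound applicable, since Y is bounded
and stays in the admissible region near maturity. -/
theorem intervalIntegrable_pathZ_mul_deriv (hS : Continuous S) (hpos : ∀ t, 0 < S t)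
    (hv : IsC12 v)
    (hcont : ContinuousOn (fun p : ℝ × ℝ => v p.1 p.2) (Icc 0 1 ×ˢ univ)) {σ r : ℝ}
    (hr : 0 ≤ r) (hσ : 0 < σ)
    (hpde : ∀ t ∈ Ico (0 : ℝ) 1, ∀ y : ℝ,
      1 / 2 * σ ^ 2 * y ^ 2 * iteratedDeriv 2 (v t) y + (1 - r * y) * deriv (v t) y
        + timeDeriv v t y = 0) :
    IntervalIntegrable (fun s => pathZ S K s * deriv (v s) (pathY S K s)) volume 0 1 := by
  obtain ⟨c, hc, hcY⟩ := exists_le_abs_pathY (K := K) hS hpos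
  obtain ⟨R, hR⟩ := isCompact_Icc.exists_bound_of_continuousOn
    ((continuous_pathY (K := K) hS hpos).continuousOn (s := Icc 0 1))
  obtain ⟨N, hN⟩ := isCompact_Icc.exists_bound_of_continuousOn (hS.continuousOn (s := Icc 0 1))
  obtain ⟨C, hC⟩ := exists_weighted_gradient_bound hv hcont hr hσ hpde hc
    (show 0 < max R 1 from lt_max_of_lt_right one_pos)
  refine intervalIntegrable_of_le_inv_sqrt (C := N * C)
    (continuousOn_pathZ_mul_deriv hS hpos hv) ?_
  filter_upwards [hcY, Ioo_mem_nhdsLT (zero_lt_one (α := ℝ))] with s hs hs1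
  have hs01 : s ∈ Icc (0 : ℝ) 1 := Ioo_subset_Icc_self hs1
  have h1 := hC s ⟨hs1.1.le, hs1.2⟩ (pathY S K s) hs ((hR s hs01).trans (le_max_left _ _))
  have hSN : |S s| ≤ N := hN s hs01
  have hZ : pathZ S K s = S s * pathY S K s := by
    rw [pathY, mul_div_cancel₀ _ (hpos s).ne']
  rw [hZ, mul_assoc, abs_mul, mul_div_assoc]
  exact mul_le_mul hSN h1 (abs_nonneg _) ((abs_nonneg _).trans hSN)

/-- The gain process of the hedge has a limit at maturity. -/
theorem exists_tendsto_gainPath (hS : Continuous S) (hpos : ∀ t, 0 < S t) (hv : IsC12 v)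
    (hcont : ContinuousOn (fun p : ℝ × ℝ => v p.1 p.2) (Icc 0 1 ×ˢ univ)) {σ r : ℝ}
    (hr : 0 ≤ r) (hσ : 0 < σ)
    (hpde : ∀ t ∈ Ico (0 : ℝ) 1, ∀ y : ℝ,
      1 / 2 * σ ^ 2 * y ^ 2 * iteratedDeriv 2 (v t) y + (1 - r * y) * deriv (v t) y
        + timeDeriv v t y = 0) :
    ∃ l, Tendsto (gainPath v r S K) (𝓝[<] 1) (𝓝 l) := by
  have hint := intervalIntegrable_pathZ_mul_deriv (K := K) hS hpos hv hcont hr hσ hpde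
  have hprim : ContinuousOn (fun t => ∫ s in (0 : ℝ)..t,
      pathZ S K s * deriv (v s) (pathY S K s)) (Icc 0 1) := by
    rw [← uIcc_of_le (zero_le_one (α := ℝ))]
    refine intervalIntegral.continuousOn_primitive_interval ?_
    rw [uIcc_of_le (zero_le_one (α := ℝ))]
    exact (intervalIntegrable_iff_integrableOn_Icc_of_le zero_le_one).1 hint
  have hcG : ContinuousOn (gainPath v r S K) (Icc 0 1) :=
    ((continuousOn_wealthPath hS hpos hcont).sub continuousOn_const).sub
      (continuousOn_const.mul hprim)
  refine ⟨_, (hcG 1 ⟨zero_le_one, le_rfl⟩).mono_left ?_⟩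
  rw [← nhdsWithin_Ioo_eq_nhdsLT (zero_lt_one (α := ℝ))]
  exact nhdsWithin_mono _ Ioo_subset_Icc_self

theorem continuousOn_gainPath (hS : Continuous S) (hpos : ∀ t, 0 < S t) (hv : IsC12 v)
    (hcont : ContinuousOn (fun p : ℝ × ℝ => v p.1 p.2) (Icc 0 1 ×ˢ univ)) (r : ℝ) :
    ContinuousOn (gainPath v r S K) (Ico 0 1) := by
  have hφc := continuousOn_pathZ_mul_deriv (K := K) hS hpos hv
  refine (((continuousOn_wealthPath hS hpos hcont).mono Ico_subset_Icc_self).sub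
    continuousOn_const).sub (continuousOn_const.mul ?_)
  intro t ht
  obtain ⟨T, htT, hT⟩ := exists_between ht.2
  have hsub : Icc 0 T ⊆ Ico 0 1 := fun x hx => ⟨hx.1, hx.2.trans_lt hT⟩
  have h1 : ContinuousOn (fun t => ∫ s in (0 : ℝ)..t,
      pathZ S K s * deriv (v s) (pathY S K s)) (Icc 0 T) := by
    rw [← uIcc_of_le (ht.1.trans htT.le)]
    refine intervalIntegral.continuousOn_primitive_interval ?_
    rw [uIcc_of_le (ht.1.trans htT.le)]
    exact (hφc.mono hsub).integrableOn_Icc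
  refine (h1 t ⟨ht.1, htT.le⟩).mono_of_mem_nhdsWithin ?_
  filter_upwards [self_mem_nhdsWithin, mem_nhdsWithin_of_mem_nhds (Iio_mem_nhds htT)] with x hx hx'
  exact ⟨hx.1, (mem_Iio.1 hx').le⟩

/-- The discounted wealth equation. -/
theorem discounted_wealthPath (hS : Continuous S) (hpos : ∀ t, 0 < S t) (hv : IsC12 v)
    (hcont : ContinuousOn (fun p : ℝ × ℝ => v p.1 p.2) (Icc 0 1 ×ˢ univ)) (r : ℝ)
    {t : ℝ} (ht : t ∈ Ico (0 : ℝ) 1) :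
    Real.exp (-(r * t)) * wealthPath v S K t = wealthPath v S K 0
      - (∫ s in (0 : ℝ)..t, Real.exp (-(r * s)) * hedgePath v S K s * S s * r)
      + (Real.exp (-(r * t)) * gainPath v r S K t
        + r * ∫ s in (0 : ℝ)..t, Real.exp (-(r * s)) * gainPath v r S K s) := by
  have hIcc : Icc 0 t ⊆ Ico 0 1 := fun x hx => ⟨hx.1, hx.2.trans_lt ht.2⟩
  set F := wealthPath v S K
  set φ : ℝ → ℝ := fun s => pathZ S K s * deriv (v s) (pathY S K s) with hφ
  have hφc : ContinuousOn φ (Icc 0 t) := (continuousOn_pathZ_mul_deriv hS hpos hv).mono hIcc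
  set I : ℝ → ℝ := fun u => ∫ s in (0 : ℝ)..u, φ s with hI
  have hIc : ContinuousOn I (Icc 0 t) := by
    rw [← uIcc_of_le ht.1]
    refine intervalIntegral.continuousOn_primitive_interval ?_
    rw [uIcc_of_le ht.1]
    exact hφc.integrableOn_Icc
  have hint : ∀ {k : ℝ → ℝ}, ContinuousOn k (Icc 0 t) → IntervalIntegrable k volume 0 t :=
    fun hk => (hk.mono (by rw [uIcc_of_le ht.1])).intervalIntegrable
  have hFc : ContinuousOn F (Icc 0 t) :=
    (continuousOn_wealthPath hS hpos hcont).mono (hIcc.trans Ico_subset_Icc_self)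
  have hec : Continuous fun s => Real.exp (-(r * s)) := by fun_prop
  have hed : ∀ s, HasDerivAt (fun s => Real.exp (-(r * s))) (Real.exp (-(r * s)) * (-r)) s :=
    fun s => by simpa using (((hasDerivAt_id' s).const_mul r).neg).exp
  have hexp : r * ∫ s in (0 : ℝ)..t, Real.exp (-(r * s)) = 1 - Real.exp (-(r * t)) := by
    have := intervalIntegral.integral_eq_sub_of_hasDerivAt (fun s _ => hed s)
      ((by fun_prop : Continuous fun s => Real.exp (-(r * s)) * (-r)).intervalIntegrable 0 t)
    rw [intervalIntegral.integral_mul_const] at this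
    simp at this
    linarith
  have hibp : ∫ s in (0 : ℝ)..t, Real.exp (-(r * s)) * φ s =
      Real.exp (-(r * t)) * I t + r * ∫ s in (0 : ℝ)..t, Real.exp (-(r * s)) * I s := by
    have := intervalIntegral.integral_mul_deriv_eq_deriv_mul_of_hasDerivAt (a := 0) (b := t)
      (u := fun s => Real.exp (-(r * s))) (u' := fun s => Real.exp (-(r * s)) * (-r))
      (v := I) (v' := φ) hec.continuousOn (by rwa [uIcc_of_le ht.1]) (fun s _ => hed s)
      (fun s hs => by
        rw [min_eq_left ht.1, max_eq_right ht.1] at hs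
        refine intervalIntegral.integral_hasDerivAt_right
          ((hφc.mono (by rw [uIcc_of_le hs.1.le]; exact Icc_subset_Icc_right hs.2.le)).intervalIntegrable)
          ?_ (hφc.continuousAt (Icc_mem_nhds hs.1 hs.2))
        exact (hφc.mono Ioo_subset_Icc_self).stronglyMeasurableAtFilter isOpen_Ioo s hs)
      ((by fun_prop : Continuous fun s => Real.exp (-(r * s)) * (-r)).intervalIntegrable _ _)
      (hint hφc)
    rw [this]
    have e : ∫ s in (0 : ℝ)..t, Real.exp (-(r * s)) * (-r) * I s =
        -(r * ∫ s in (0 : ℝ)..t, Real.exp (-(r * s)) * I s) := by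
      rw [← intervalIntegral.integral_const_mul, ← intervalIntegral.integral_neg]
      congr 1; ext s; ring
    rw [e]
    simp [hI]
  -- This is hS = F − Z ∂_y v in integrated form.
  have hH : ∫ s in (0 : ℝ)..t, Real.exp (-(r * s)) * hedgePath v S K s * S s * r =
      r * ((∫ s in (0 : ℝ)..t, Real.exp (-(r * s)) * F s)
        - ∫ s in (0 : ℝ)..t, Real.exp (-(r * s)) * φ s) := by
    rw [← intervalIntegral.integral_sub (hint (hec.continuousOn.fun_mul hFc))
      (hint (hec.continuousOn.fun_mul hφc)), ← intervalIntegral.integral_const_mul]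
    congr 1; ext s
    have hZ : pathZ S K s = S s * pathY S K s := by
      rw [pathY, mul_div_cancel₀ _ (hpos s).ne']
    simp only [F, hφ, wealthPath, hedgePath]
    rw [hZ]; ring
  have hG : ∫ s in (0 : ℝ)..t, Real.exp (-(r * s)) * gainPath v r S K s =
      (∫ s in (0 : ℝ)..t, Real.exp (-(r * s)) * F s)
        - (∫ s in (0 : ℝ)..t, Real.exp (-(r * s))) * F 0
        - r * ∫ s in (0 : ℝ)..t, Real.exp (-(r * s)) * I s := by
    rw [← intervalIntegral.integral_mul_const, ← intervalIntegral.integral_const_mul,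
      ← intervalIntegral.integral_sub (hint (hec.continuousOn.fun_mul hFc))
        (hint (hec.continuousOn.fun_mul continuousOn_const)),
      ← intervalIntegral.integral_sub
        (hint ((hec.continuousOn.fun_mul hFc).fun_sub (hec.continuousOn.fun_mul continuousOn_const)))
        (hint (continuousOn_const.fun_mul (hec.continuousOn.fun_mul hIc)))]
    congr 1; ext s
    simp only [gainPath, hI, F, hφ]
    ring
  rw [hH, hibp, hG]
  simp only [gainPath]
  change _ = F 0 - _ + (_ * (F t - F 0 - r * I t) + _)
  linear_combination F 0 * hexp

end Path

/-! ### From pathwise limits to convergence in probability; measurability. -/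

section Processes

variable {Ω : Type*}

theorem tendstoInMeasure_of_forall_subseq_ae [MeasurableSpace Ω] {μ : Measure Ω} [IsFiniteMeasure μ]
    {f : ℝ → Ω → ℝ} {g : Ω → ℝ} (hf : ∀ ε > 0, AEStronglyMeasurable (f ε) μ)
    (h : ∀ ε : ℕ → ℝ, Tendsto ε atTop (𝓝[>] 0) →
      ∃ ms : ℕ → ℕ, ∀ᵐ ω ∂μ, Tendsto (fun k => f (ε (ms k)) ω) atTop (𝓝 (g ω))) :
    TendstoInMeasure μ f (𝓝[>] 0) g := by
  intro δ hδ
  refine tendsto_of_subseq_tendsto fun ns hns => ?_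
  obtain ⟨N, hN⟩ := eventually_atTop.1 (hns.eventually self_mem_nhdsWithin)
  -- The sequence is shifted by N so that all its terms are positive, where measurability is
  -- available.
  obtain ⟨ms, hms⟩ := h (fun n => ns (n + N)) (hns.comp (tendsto_add_atTop_nat N))
  exact ⟨fun k => ms k + N, tendstoInMeasure_of_tendsto_ae
    (fun k => hf _ (hN (ms k + N) (Nat.le_add_left _ _))) hms δ hδ⟩

/-- Borel–Cantelli with thresholds 2⁻ᵏ. The supremum over t inside the event makes one null set
serve all times at once. -/
theorem TendstoUCP.exists_subseq_ae [MeasurableSpace Ω] {μ : Measure Ω} {T : ℝ}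
    {F : ℝ → ℝ → Ω → ℝ} {G : ℝ → Ω → ℝ} (h : TendstoUCP μ T F G) {ε : ℕ → ℝ}
    (hε : Tendsto ε atTop (𝓝[>] 0)) :
    ∃ ms : ℕ → ℕ, StrictMono ms ∧ ∀ᵐ ω ∂μ, ∀ t ∈ Icc 0 T,
      Tendsto (fun k => F (ε (ms k)) t ω) atTop (𝓝 (G t ω)) := by
  have hδ : ∀ k : ℕ, (0 : ENNReal) < 2⁻¹ ^ k := fun k => ENNReal.pow_pos (by simp) k
  obtain ⟨ms, hms, hμ⟩ := extraction_forall_of_eventually (P := fun k n =>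
    μ {ω | 2⁻¹ ^ k ≤ ⨆ t ∈ Icc (0 : ℝ) T, edist (F (ε n) t ω) (G t ω)} ≤ 2⁻¹ ^ k)
    fun k => ENNReal.tendsto_nhds_zero.1 ((h _ (hδ k)).comp hε) _ (hδ k)
  refine ⟨ms, hms, ?_⟩
  have hsum : ∑' k, μ {ω | 2⁻¹ ^ k ≤ ⨆ t ∈ Icc (0 : ℝ) T,
      edist (F (ε (ms k)) t ω) (G t ω)} ≠ ⊤ := by
    refine ne_top_of_le_ne_top ?_ (ENNReal.tsum_le_tsum hμ)
    rw [ENNReal.tsum_geometric]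
    simp
  filter_upwards [ae_eventually_notMem hsum] with ω hω t ht
  rw [tendsto_iff_edist_tendsto_0]
  refine tendsto_of_tendsto_of_tendsto_of_le_of_le' tendsto_const_nhds
    (ENNReal.tendsto_pow_atTop_nhds_zero_of_lt_one (r := 2⁻¹) (by simp))
    (Eventually.of_forall fun _ => zero_le) ?_
  filter_upwards [hω] with k hk
  rw [not_le] at hk
  exact (le_iSup₂ (f := fun t (_ : t ∈ Icc (0 : ℝ) T) =>
    edist (F (ε (ms k)) t ω) (G t ω)) t ht).trans hk.le

/-- Path continuity and measurability at each time give joint measurability. The σ-algebra is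
arbitrary, so this also serves adaptedness. -/
theorem measurable_integral_of_continuousOn {m : MeasurableSpace Ω} {a b : ℝ} (hab : a ≤ b)
    {f : ℝ → Ω → ℝ} (hc : ∀ ω, ContinuousOn (fun s => f s ω) (Icc a b))
    (hm : ∀ s ∈ Icc a b, Measurable (f s)) : Measurable fun ω => ∫ s in a..b, f s ω := by
  set c : ℝ → ℝ := fun s => max a (min s b)
  have hcm : ∀ s, c s ∈ Icc a b := fun s => ⟨le_max_left _ _, max_le hab (min_le_right _ _)⟩
  have hjoint : StronglyMeasurable (Function.uncurry fun s ω => f (c s) ω) :=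
    stronglyMeasurable_uncurry_of_continuous_of_stronglyMeasurable
      (fun ω => (hc ω).comp_continuous (by fun_prop) hcm)
      fun s => (hm _ (hcm s)).stronglyMeasurable
  have heq : (fun ω => ∫ s in a..b, f s ω) = fun ω => ∫ s in Ioc a b, f (c s) ω := by
    ext ω
    rw [intervalIntegral.integral_of_le hab]
    refine setIntegral_congr_fun measurableSet_Ioc fun s hs => ?_
    simp only [c]
    rw [min_eq_left hs.2, max_eq_right hs.1.le]
  rw [heq]
  exact hjoint.integral_prod_left.measurable

section PathMeasurability

variable {m : MeasurableSpace Ω} {v : ℝ → ℝ → ℝ} {S : ℝ → Ω → ℝ} {K t : ℝ}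

theorem measurable_pathZ (hc : ∀ ω, Continuous fun s => S s ω) (ht : 0 ≤ t)
    (hm : ∀ s ∈ Icc 0 t, Measurable (S s)) : Measurable fun ω => pathZ (fun s => S s ω) K t :=
  (measurable_integral_of_continuousOn ht (fun ω => (hc ω).continuousOn) hm).sub_const K

theorem measurable_pathY (hc : ∀ ω, Continuous fun s => S s ω) (ht : 0 ≤ t)
    (hm : ∀ s ∈ Icc 0 t, Measurable (S s)) : Measurable fun ω => pathY (fun s => S s ω) K t :=
  (measurable_pathZ hc ht hm).div (hm t ⟨ht, le_rfl⟩)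

theorem IsC12.measurable_deriv (hv : IsC12 v) (ht : t ∈ Ico (0 : ℝ) 1) :
    Measurable (deriv (v t)) :=
  ((hv.space_diff t ht).continuous_deriv (by norm_num)).measurable

theorem measurable_wealthPath (hv : IsC12 v) (hc : ∀ ω, Continuous fun s => S s ω)
    (ht : t ∈ Ico (0 : ℝ) 1) (hm : ∀ s ∈ Icc 0 t, Measurable (S s)) :
    Measurable fun ω => wealthPath v (fun s => S s ω) K t :=
  ((hv.space_diff t ht).continuous.measurable.comp (measurable_pathY hc ht.1 hm)).mul
    (hm t ⟨ht.1, le_rfl⟩)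

theorem measurable_hedgePath (hv : IsC12 v) (hc : ∀ ω, Continuous fun s => S s ω)
    (ht : t ∈ Ico (0 : ℝ) 1) (hm : ∀ s ∈ Icc 0 t, Measurable (S s)) :
    Measurable fun ω => hedgePath v (fun s => S s ω) K t :=
  ((hv.space_diff t ht).continuous.measurable.comp (measurable_pathY hc ht.1 hm)).sub
    (((hv.measurable_deriv ht).comp (measurable_pathY hc ht.1 hm)).mul
      (measurable_pathY hc ht.1 hm))

theorem measurable_gainPath (hv : IsC12 v) (hc : ∀ ω, Continuous fun s => S s ω)
    (hpos : ∀ ω t, 0 < S t ω) (r : ℝ) (ht : t ∈ Ico (0 : ℝ) 1)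
    (hm : ∀ s ∈ Icc 0 t, Measurable (S s)) :
    Measurable fun ω => gainPath v r (fun s => S s ω) K t := by
  have hm' : ∀ s ∈ Icc 0 t, ∀ u ∈ Icc 0 s, Measurable (S u) :=
    fun s hs u hu => hm u ⟨hu.1, hu.2.trans hs.2⟩
  refine ((measurable_wealthPath hv hc ht hm).sub (measurable_wealthPath hv hc
    ⟨le_rfl, zero_lt_one⟩ (hm' 0 ⟨le_rfl, ht.1⟩))).sub (Measurable.const_mul ?_ r)
  refine measurable_integral_of_continuousOn ht.1 (fun ω =>
    (continuousOn_pathZ_mul_deriv (hc ω) (hpos ω) hv).mono fun x hx => ⟨hx.1, hx.2.trans_lt ht.2⟩)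
    fun s hs => ?_
  exact (measurable_pathZ hc hs.1 (hm' s hs)).mul
    ((hv.measurable_deriv ⟨hs.1, hs.2.trans_lt ht.2⟩).comp (measurable_pathY hc hs.1 (hm' s hs)))

end PathMeasurability

/-! ### Modification of the price process with every path continuous and positive. -/

open Classical in
/-- Modification of a process on `[0,1]`: constant outside `[0,1]`, and `1` outside the event `G`. -/
noncomputable def regularized (G : Set Ω) (S : ℝ → Ω → ℝ) (t : ℝ) (ω : Ω) : ℝ :=
  if ω ∈ G then S (max 0 (min t 1)) ω else 1

section Regularized

variable {G : Set Ω} {S : ℝ → Ω → ℝ} {v : ℝ → ℝ → ℝ} {K : ℝ}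

theorem clamp_mem (t : ℝ) : max 0 (min t 1) ∈ Icc (0 : ℝ) 1 :=
  ⟨le_max_left _ _, max_le zero_le_one (min_le_right _ _)⟩

theorem regularized_eq {ω : Ω} (hω : ω ∈ G) {t : ℝ} (ht : t ∈ Icc (0 : ℝ) 1) :
    regularized G S t ω = S t ω := by
  rw [regularized, if_pos hω, min_eq_left ht.2, max_eq_right ht.1]

theorem continuous_regularized (hG : ∀ ω ∈ G, ContinuousOn (fun t => S t ω) (Icc 0 1)) (ω : Ω) :
    Continuous fun t => regularized G S t ω := by
  by_cases hω : ω ∈ G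
  · simp only [regularized, if_pos hω]
    exact (hG ω hω).comp_continuous (by fun_prop) clamp_mem
  · simp only [regularized, if_neg hω]
    exact continuous_const

theorem regularized_pos (hG : ∀ ω ∈ G, ∀ t ∈ Icc (0 : ℝ) 1, 0 < S t ω) (ω : Ω) (t : ℝ) :
    0 < regularized G S t ω := by
  by_cases hω : ω ∈ G
  · simp only [regularized, if_pos hω]
    exact hG ω hω _ (clamp_mem t)
  · simp [regularized, if_neg hω]

theorem measurable_regularized {m : MeasurableSpace Ω} (hG : MeasurableSet G) {t : ℝ}
    (ht : t ∈ Icc (0 : ℝ) 1) (hS : Measurable (S t)) : Measurable (regularized G S t) := by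
  unfold regularized
  rw [min_eq_left ht.2, max_eq_right ht.1]
  exact Measurable.ite hG hS measurable_const

theorem pathZ_regularized {ω : Ω} (hω : ω ∈ G) {t : ℝ} (ht : t ∈ Icc (0 : ℝ) 1) :
    pathZ (fun s => regularized G S s ω) K t = asianZ S K t ω := by
  rw [pathZ, asianZ]
  congr 1
  refine intervalIntegral.integral_congr fun s hs => ?_
  rw [uIcc_of_le ht.1] at hs
  exact regularized_eq hω ⟨hs.1, hs.2.trans ht.2⟩

theorem pathY_regularized {ω : Ω} (hω : ω ∈ G) {t : ℝ} (ht : t ∈ Icc (0 : ℝ) 1) :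
    pathY (fun s => regularized G S s ω) K t = asianZ S K t ω / S t ω := by
  rw [pathY, pathZ_regularized hω ht, regularized_eq hω ht]

theorem hedgePath_regularized {ω : Ω} (hω : ω ∈ G) {t : ℝ} (ht : t ∈ Icc (0 : ℝ) 1) :
    hedgePath v (fun s => regularized G S s ω) K t = asianHedge v S K t ω := by
  rw [hedgePath, asianHedge, pathY_regularized hω ht]

theorem wealthPath_regularized {ω : Ω} (hω : ω ∈ G) {t : ℝ} (ht : t ∈ Icc (0 : ℝ) 1) :
    wealthPath v (fun s => regularized G S s ω) K t = v t (asianZ S K t ω / S t ω) * S t ω := by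
  rw [wealthPath, pathY_regularized hω ht, regularized_eq hω ht]

/-- Truncating the integrand shortens the range of integration but does not stop S: increments
starting before T still look beyond it. -/
theorem forwardReg_truncAt_asianHedge {ω : Ω} (hω : ω ∈ G) {T t ε : ℝ} (hT : T ∈ Ico (0 : ℝ) 1)
    (ht : t ∈ Icc (0 : ℝ) 1) (hε : 0 < ε) :
    forwardReg 1 (truncAt T (asianHedge v S K)) S ε t ω =
      ε⁻¹ * ∫ s in (0 : ℝ)..min t T, hedgePath v (fun s => regularized G S s ω) K s *
        (regularized G S (min (s + ε) 1) ω - regularized G S s ω) := by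
  rw [forwardReg]
  congr 1
  have hind : ∀ s, truncAt T (asianHedge v S K) s ω * (S (min (s + ε) 1) ω - S s ω) =
      (Icc 0 T).indicator (fun s => asianHedge v S K s ω * (S (min (s + ε) 1) ω - S s ω)) s := by
    intro s
    by_cases hs : s ∈ Icc 0 T <;> simp [truncAt, hs]
  simp_rw [hind]
  rw [intervalIntegral.integral_of_le ht.1, intervalIntegral.integral_of_le (le_min ht.1 hT.1),
    setIntegral_indicator measurableSet_Icc]
  have hset : Ioc 0 t ∩ Icc 0 T = Ioc 0 (min t T) := by
    ext s
    simp only [mem_inter_iff, mem_Ioc, mem_Icc, le_min_iff]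
    constructor
    · rintro ⟨⟨h1, h2⟩, -, h3⟩; exact ⟨h1, h2, h3⟩
    · rintro ⟨h1, h2, h3⟩; exact ⟨⟨h1, h2⟩, h1.le, h3⟩
  rw [hset]
  refine setIntegral_congr_fun measurableSet_Ioc fun s hs => ?_
  have hs1 : s ∈ Icc (0 : ℝ) 1 := ⟨hs.1.le, hs.2.trans ((min_le_left _ _).trans ht.2)⟩
  have hs2 : min (s + ε) 1 ∈ Icc (0 : ℝ) 1 :=
    ⟨le_min (by linarith [hs.1]) zero_le_one, min_le_right _ _⟩
  rw [hedgePath_regularized hω hs1, regularized_eq hω hs1, regularized_eq hω hs2]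

end Regularized

/-! ### The two forward integrals. -/

section Integrals

variable {m : MeasurableSpace Ω} {μ : Measure Ω} [IsProbabilityMeasure μ] {G : Set Ω}
  {S : ℝ → Ω → ℝ} {v : ℝ → ℝ → ℝ} {K σ r : ℝ}

/-- The Itô formula for the hedge, as a forward integral. -/
theorem isForwardIntegral_asianHedge (hGm : MeasurableSet G) (hGμ : ∀ᵐ ω ∂μ, ω ∈ G)
    (hGc : ∀ ω ∈ G, ContinuousOn (fun t => S t ω) (Icc 0 1))
    (hGpos : ∀ ω ∈ G, ∀ t ∈ Icc (0 : ℝ) 1, 0 < S t ω)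
    (hSm : ∀ t ∈ Icc (0 : ℝ) 1, Measurable (S t))
    (hqv : IsCovariation μ 1 S S (fun t ω => ∫ s in (0 : ℝ)..t, σ ^ 2 * S s ω ^ 2))
    (hv : IsC12 v) (hcont : ContinuousOn (fun p : ℝ × ℝ => v p.1 p.2) (Icc 0 1 ×ˢ univ))
    (hpde : ∀ t ∈ Ico (0 : ℝ) 1, ∀ y : ℝ,
      1 / 2 * σ ^ 2 * y ^ 2 * iteratedDeriv 2 (v t) y + (1 - r * y) * deriv (v t) y
        + timeDeriv v t y = 0) {T : ℝ} (hT : T ∈ Ico (0 : ℝ) 1) :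
    IsForwardIntegral μ 1 (truncAt T (asianHedge v S K)) S
      (fun t ω => gainPath v r (fun s => regularized G S s ω) K (min t T)) := by
  have hRc := continuous_regularized hGc
  have hRpos := regularized_pos hGpos
  have hRm : ∀ t ∈ Icc (0 : ℝ) 1, Measurable (regularized G S t) :=
    fun t ht => measurable_regularized hGm ht (hSm t ht)
  have hIcc : Icc 0 T ⊆ Ico 0 1 := fun x hx => ⟨hx.1, hx.2.trans_lt hT.2⟩
  constructor
  · filter_upwards [hGμ] with ω hω using hGc ω hω
  · filter_upwards [hGμ] with ω hω
    have h1 : IntegrableOn (fun t => asianHedge v S K t ω) (Icc 0 T) :=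
      ((continuousOn_hedgePath (K := K) (hRc ω) (hRpos ω) hv hcont).mono hIcc).integrableOn_Icc.congr_fun
        (fun t ht => hedgePath_regularized hω (Ico_subset_Icc_self (hIcc ht))) measurableSet_Icc
    exact (h1.integrable_indicator measurableSet_Icc).integrableOn
  · refine Eventually.of_forall fun ω => ?_
    exact (continuousOn_gainPath (hRc ω) (hRpos ω) hv hcont r).comp (f := fun t => min t T)
      (by fun_prop) fun t ht => ⟨le_min ht.1 hT.1, (min_le_right _ _).trans_lt hT.2⟩
  · intro t ht
    have ht' : min t T ∈ Ico (0 : ℝ) 1 := ⟨le_min ht.1 hT.1, (min_le_right _ _).trans_lt hT.2⟩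
    have hsub : Icc 0 (min t T) ⊆ Ico 0 1 := fun x hx => ⟨hx.1, hx.2.trans_lt ht'.2⟩
    refine tendstoInMeasure_of_forall_subseq_ae (fun ε hε => ?_) fun ε hε => ?_
    · have hmeas : Measurable fun ω => ε⁻¹ * ∫ s in (0 : ℝ)..min t T,
          hedgePath v (fun s => regularized G S s ω) K s *
            (regularized G S (min (s + ε) 1) ω - regularized G S s ω) := by
        refine (measurable_integral_of_continuousOn ht'.1 (fun ω => ?_) fun s hs => ?_).const_mul _
        · have := hRc ω
          refine ((continuousOn_hedgePath (K := K) (hRc ω) (hRpos ω) hv hcont).mono hsub).mul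
            (Continuous.continuousOn ?_)
          exact (this.comp (by fun_prop : Continuous fun s : ℝ => min (s + ε) 1)).sub this
        · have hs1 := hsub hs
          refine (measurable_hedgePath hv hRc hs1 fun u hu => hRm u ⟨hu.1, hu.2.trans hs1.2.le⟩).mul
            ((hRm _ ⟨le_min (by linarith [hs.1, hε.lt]) zero_le_one, min_le_right _ _⟩).sub
              (hRm s (Ico_subset_Icc_self hs1)))
      -- The integral formed with S agrees on G with the measurable one formed with the
      -- modification, which suffices for almost everywhere measurability.
      refine hmeas.aestronglyMeasurable.congr ?_
      filter_upwards [hGμ] with ω hω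
      exact (forwardReg_truncAt_asianHedge hω hT ht hε).symm
    · obtain ⟨ms, hms, hae⟩ := TendstoUCP.exists_subseq_ae hqv hε
      refine ⟨ms, ?_⟩
      have hε' := hε.comp hms.tendsto_atTop
      filter_upwards [hGμ, hae] with ω hω hωqv
      have key := tendsto_forward_hedgePath (K := K) (hRc ω) (hRpos ω) hv hcont hpde hε' (fun u hu => by
        have hlim : ∫ s in (0 : ℝ)..u, σ ^ 2 * regularized G S s ω ^ 2 =
            ∫ s in (0 : ℝ)..u, σ ^ 2 * S s ω ^ 2 := by
          refine intervalIntegral.integral_congr fun s hs => ?_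
          rw [uIcc_of_le hu.1] at hs
          simp only [regularized_eq hω ⟨hs.1, hs.2.trans hu.2⟩]
        rw [hlim]
        refine (hωqv u hu).congr' ?_
        filter_upwards [hε'.eventually self_mem_nhdsWithin] with n hn
        rw [covarReg]
        congr 1
        refine intervalIntegral.integral_congr fun s hs => ?_
        rw [uIcc_of_le hu.1] at hs
        have hn0 : 0 < ε (ms n) := hn
        have hs1 : s ∈ Icc (0 : ℝ) 1 := ⟨hs.1, hs.2.trans hu.2⟩
        have hs2 : min (s + ε (ms n)) 1 ∈ Icc (0 : ℝ) 1 :=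
          ⟨le_min (by linarith [hs.1]) zero_le_one, min_le_right _ _⟩
        simp only [Function.comp, regularized_eq hω hs1, regularized_eq hω hs2]) ht'
      refine key.congr' ?_
      filter_upwards [hε'.eventually self_mem_nhdsWithin] with n hn
      exact (forwardReg_truncAt_asianHedge hω hT ht hn).symm

/-- Forward integral of the discount factor against a process with continuous paths. -/
theorem isForwardIntegral_exp {T : ℝ} (hT : 0 ≤ T) (r : ℝ) {J : ℝ → Ω → ℝ}
    (hJc : ∀ ω, ContinuousOn (fun t => J t ω) (Icc 0 T)) (hJm : ∀ t ∈ Icc 0 T, Measurable (J t)) :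
    IsForwardIntegral μ T (fun t _ => Real.exp (-(r * t))) J
      (fun t ω => Real.exp (-(r * t)) * J t ω - J 0 ω
        + r * ∫ s in (0 : ℝ)..t, Real.exp (-(r * s)) * J s ω) := by
  have hec : Continuous fun t => Real.exp (-(r * t)) := by fun_prop
  set c : ℝ → ℝ := fun s => max 0 (min s T) with hc
  have hcm : ∀ s, c s ∈ Icc 0 T := fun s => ⟨le_max_left _ _, max_le hT (min_le_right _ _)⟩
  have hceq : ∀ s ∈ Icc 0 T, c s = s := fun s hs => by
    simp only [hc]; rw [min_eq_left hs.2, max_eq_right hs.1]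
  have hJcc : ∀ ω, Continuous fun s => J (c s) ω :=
    fun ω => (hJc ω).comp_continuous (by fun_prop) hcm
  have hreg : ∀ t ∈ Icc 0 T, ∀ ε > 0, ∀ ω, forwardReg T (fun t _ => Real.exp (-(r * t))) J ε t ω =
      ε⁻¹ * ∫ s in (0 : ℝ)..t, Real.exp (-(r * s)) * (J (c (s + ε)) ω - J (c s) ω) := by
    intro t ht ε hε ω
    rw [forwardReg]
    congr 1
    refine intervalIntegral.integral_congr fun s hs => ?_
    rw [uIcc_of_le ht.1] at hs
    have h1 : c (s + ε) = min (s + ε) T :=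
      max_eq_right (le_min (by linarith [hs.1]) hT)
    simp only [h1, hceq s ⟨hs.1, hs.2.trans ht.2⟩]
  constructor
  · exact Eventually.of_forall hJc
  · exact Eventually.of_forall fun _ => hec.continuousOn.integrableOn_Icc
  · refine Eventually.of_forall fun ω => ?_
    refine ((hec.continuousOn.mul (hJc ω)).sub continuousOn_const).add (continuousOn_const.mul ?_)
    rw [← uIcc_of_le hT]
    refine intervalIntegral.continuousOn_primitive_interval ?_
    rw [uIcc_of_le hT]
    exact (hec.continuousOn.mul (hJc ω)).integrableOn_Icc
  · intro t ht
    refine tendstoInMeasure_of_forall_subseq_ae (fun ε hε => ?_)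
      fun ε hε => ⟨id, Eventually.of_forall fun ω => ?_⟩
    · refine Measurable.aestronglyMeasurable ?_
      rw [funext (hreg t ht ε hε)]
      refine (measurable_integral_of_continuousOn ht.1 (fun ω => Continuous.continuousOn ?_)
        fun s hs => ?_).const_mul _
      · exact hec.mul (((hJcc ω).comp (by fun_prop : Continuous fun s : ℝ => s + ε)).sub (hJcc ω))
      · exact ((hJm _ (hcm _)).sub (hJm _ (hcm _))).const_mul _
    · have h1 := (tendsto_exp_forward_average r (hJcc ω) t).comp hε
      have hint : ∫ s in (0 : ℝ)..t, Real.exp (-(r * s)) * J (c s) ω =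
          ∫ s in (0 : ℝ)..t, Real.exp (-(r * s)) * J s ω := by
        refine intervalIntegral.integral_congr fun s hs => ?_
        rw [uIcc_of_le ht.1] at hs
        simp only [hceq s ⟨hs.1, hs.2.trans ht.2⟩]
      rw [hceq t ht, hceq 0 ⟨le_rfl, hT⟩, hint] at h1
      refine h1.congr' ?_
      filter_upwards [hε.eventually self_mem_nhdsWithin] with n hn
      exact (hreg t ht _ hn ω).symm

end Integrals

/-- Meant for 𝒢_t: it contains all subsets of the exceptional null set, so adaptedness passes from
the modified hedge to the original one. -/
theorem measurable_of_eqOn_of_compl {m : MeasurableSpace Ω} {G : Set Ω} {f g : Ω → ℝ}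
    (hg : Measurable g) (hfg : EqOn f g G) (hG : ∀ s ⊆ Gᶜ, MeasurableSet s) : Measurable f := by
  intro s hs
  have hGm : MeasurableSet G := (hG _ Subset.rfl).of_compl
  have h : f ⁻¹' s = (g ⁻¹' s ∩ G) ∪ (f ⁻¹' s ∩ Gᶜ) := by
    ext ω
    by_cases hω : ω ∈ G <;> simp [hω]
    rw [hfg hω]
  rw [h]
  exact ((hg hs).inter hGm).union (hG _ inter_subset_right)

end Processes

/-! ### Assembly of the proposition. -/

theorem mainTheorem10 {Ω : Type*} {m : MeasurableSpace Ω} (μ : Measure Ω) [IsProbabilityMeasure μ]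
    (𝒢 : Filtration unitInterval m) (h𝒢 : UsualConditions μ 𝒢)
    (r σ K : ℝ) (hr : 0 < r) (hσ : 0 < σ) (hK : 0 < K)
    (S : ℝ → Ω → ℝ)
    (hS_adapted : ∀ t : unitInterval, Measurable[𝒢 t] (S t))
    (hS_cont : ∀ᵐ ω ∂μ, ContinuousOn (fun t => S t ω) (Icc 0 1))
    (hS_pos : ∀ᵐ ω ∂μ, ∀ t ∈ Icc (0 : ℝ) 1, 0 < S t ω)
    (hS_qv : IsCovariation μ 1 S S (fun t ω => ∫ s in (0 : ℝ)..t, σ ^ 2 * S s ω ^ 2))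
    (ψ : ℝ → ℝ) (hψ : Continuous ψ)
    (v : ℝ → ℝ → ℝ) (hv : IsC12 v)
    (hv_cont : ContinuousOn (fun p : ℝ × ℝ => v p.1 p.2) (Icc 0 1 ×ˢ univ))
    (hv_pde : ∀ t ∈ Ico (0 : ℝ) 1, ∀ y : ℝ,
      1 / 2 * σ ^ 2 * y ^ 2 * iteratedDeriv 2 (v t) y + (1 - r * y) * deriv (v t) y
        + timeDeriv v t y = 0)
    (hv_terminal : ∀ y : ℝ, v 1 y = ψ y) :
    IsSelfFinancingPortfolio μ 𝒢 S (fun ω => v 0 (-K / S 0 ω) * S 0 ω) (asianHedge v S K) ∧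
    Replicates μ r S (fun ω => v 0 (-K / S 0 ω) * S 0 ω) (asianHedge v S K)
      (fun ω => ψ (((∫ t in (0 : ℝ)..1, S t ω) - K) / S 1 ω) * S 1 ω) := by
  set G : Set Ω := {ω | ContinuousOn (fun t => S t ω) (Icc 0 1) ∧
    ∀ t ∈ Icc (0 : ℝ) 1, 0 < S t ω} with hG
  have hGμ : ∀ᵐ ω ∂μ, ω ∈ G := hS_cont.and hS_pos
  have hGc : ∀ ω ∈ G, ContinuousOn (fun t => S t ω) (Icc 0 1) := fun ω hω => hω.1
  have hGpos : ∀ ω ∈ G, ∀ t ∈ Icc (0 : ℝ) 1, 0 < S t ω := fun ω hω => hω.2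
  have hnull : ∀ (t : unitInterval) (s : Set Ω), s ⊆ Gᶜ → MeasurableSet[𝒢 t] s :=
    fun t s hs => 𝒢.mono (show (0 : unitInterval) ≤ t from t.2.1) _
      (h𝒢.2 s (measure_mono_null hs hGμ))
  have hGm : ∀ t : unitInterval, MeasurableSet[𝒢 t] G :=
    fun t => (@MeasurableSet.compl_iff _ _ (𝒢 t)).1 (hnull t _ Subset.rfl)
  have hGm' : MeasurableSet G := 𝒢.le 0 _ (hGm 0)
  have hSm : ∀ t ∈ Icc (0 : ℝ) 1, Measurable (S t) :=
    fun t ht => (hS_adapted ⟨t, ht⟩).mono (𝒢.le _) le_rfl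
  have hRc := continuous_regularized hGc
  have hRpos := regularized_pos hGpos
  have hRm : ∀ t ∈ Icc (0 : ℝ) 1, Measurable (regularized G S t) :=
    fun t ht => measurable_regularized hGm' ht (hSm t ht)
  set J : ℝ → Ω → ℝ := fun t ω => gainPath v r (fun s => regularized G S s ω) K t with hJ
  have hJc : ∀ ω, ContinuousOn (fun t => J t ω) (Ico 0 1) :=
    fun ω => continuousOn_gainPath (hRc ω) (hRpos ω) hv hv_cont r
  have hfwd : ∀ T ∈ Ico (0 : ℝ) 1, IsForwardIntegral μ 1 (truncAt T (asianHedge v S K)) S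
      (fun t ω => J (min t T) ω) := fun T hT =>
    isForwardIntegral_asianHedge hGm' hGμ hGc hGpos hSm hS_qv hv hv_cont hv_pde hT
  have hlocal : IsLocalForwardIntegral μ (asianHedge v S K) S J :=
    ⟨Eventually.of_forall hJc, fun T hT => ⟨_, hfwd T hT,
      Eventually.of_forall fun ω s hs => by simp only [min_eq_left hs.2]⟩⟩
  refine ⟨⟨?_, ?_, ?_, fun T hT => ⟨_, hfwd T hT⟩⟩,
    ⟨J, hlocal, Eventually.of_forall fun ω =>
      exists_tendsto_gainPath (hRc ω) (hRpos ω) hv hv_cont hr.le hσ hv_pde⟩,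
    -- The wealth process is v(t, Y_t) S_t; the discounted integral W below is the integration by
    -- parts formula for e^{−rt} against J.
    fun t ω => wealthPath v (fun s => regularized G S s ω) K t,
    ⟨J, fun t ω => Real.exp (-(r * t)) * J t ω - J 0 ω
      + r * ∫ s in (0 : ℝ)..t, Real.exp (-(r * s)) * J s ω, hlocal, ?_, ?_⟩, ?_⟩
  · have hS0 : Measurable[𝒢 0] (S 0) := by simpa using hS_adapted 0
    exact ((hv.space_diff 0 ⟨le_rfl, zero_lt_one⟩).continuous.measurable.comp
      (hS0.const_div (-K))).mul hS0
  · intro t ht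
    refine measurable_of_eqOn_of_compl (m := 𝒢 t) (G := G)
      (measurable_hedgePath (m := 𝒢 t) (K := K) hv hRc ⟨t.2.1, ht⟩ fun s hs => ?_)
      (fun ω hω => (hedgePath_regularized hω t.2).symm) (hnull t)
    have hs1 : s ∈ Icc (0 : ℝ) 1 := ⟨hs.1, hs.2.trans t.2.2⟩
    exact measurable_regularized (m := 𝒢 t) (hGm t) hs1
      ((hS_adapted ⟨s, hs1⟩).mono (𝒢.mono (show (⟨s, hs1⟩ : unitInterval) ≤ t from hs.2)) le_rfl)
  · filter_upwards [hGμ] with ω hω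
    have hc : ContinuousOn (fun t => asianHedge v S K t ω) (Ico 0 1) :=
      (continuousOn_hedgePath (K := K) (hRc ω) (hRpos ω) hv hv_cont).congr
        fun t ht => (hedgePath_regularized hω (Ico_subset_Icc_self ht)).symm
    exact ⟨fun t ht => (hc t ht).mono fun s hs => ⟨hs.1, hs.2.trans ht.2⟩,
      fun k hk hks => (hk.image_of_continuousOn (hc.mono hks)).isBounded⟩
  · exact fun T hT => isForwardIntegral_exp hT.1 r
      (fun ω => (hJc ω).mono fun x hx => ⟨hx.1, hx.2.trans_lt hT.2⟩)
      fun t ht => measurable_gainPath hv hRc hRpos r ⟨ht.1, ht.2.trans_lt hT.2⟩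
        fun s hs => hRm s ⟨hs.1, (hs.2.trans ht.2).trans hT.2.le⟩
  · filter_upwards [hGμ] with ω hω t ht
    have h0 : (0 : ℝ) ∈ Icc (0 : ℝ) 1 := ⟨le_rfl, zero_le_one⟩
    have hJ0 : J 0 ω = 0 := by simp [hJ, gainPath]
    have hF0 : wealthPath v (fun s => regularized G S s ω) K 0 = v 0 (-K / S 0 ω) * S 0 ω := by
      rw [wealthPath_regularized hω h0]
      simp [asianZ]
    have hint : ∫ s in (0 : ℝ)..t, Real.exp (-(r * s)) *
        hedgePath v (fun s => regularized G S s ω) K s * regularized G S s ω * r =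
        ∫ s in (0 : ℝ)..t, Real.exp (-(r * s)) * asianHedge v S K s ω * S s ω * r := by
      refine intervalIntegral.integral_congr fun s hs => ?_
      rw [uIcc_of_le ht.1] at hs
      have hs1 : s ∈ Icc (0 : ℝ) 1 := ⟨hs.1, hs.2.trans ht.2.le⟩
      simp only [hedgePath_regularized hω hs1, regularized_eq hω hs1]
    rw [discounted_wealthPath (hRc ω) (hRpos ω) hv hv_cont r ht, hF0, hint, hJ0, sub_zero]
  · filter_upwards [hGμ] with ω hω
    have h1 : (1 : ℝ) ∈ Icc (0 : ℝ) 1 := ⟨zero_le_one, le_rfl⟩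
    have hlim := (continuousOn_wealthPath (K := K) (hRc ω) (hRpos ω) hv_cont 1 h1).mono_left
      (show 𝓝[<] (1 : ℝ) ≤ 𝓝[Icc 0 1] 1 by
        rw [← nhdsWithin_Ioo_eq_nhdsLT (zero_lt_one (α := ℝ))]
        exact nhdsWithin_mono _ Ioo_subset_Icc_self)
    rwa [wealthPath_regularized hω h1, hv_terminal] at hlim
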